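/- Let $\mathcal P=\{\nu_\theta:\theta\in\Theta\}$ be a one-parameter canonical exponential family on $\mathbb R$: $\Theta\subseteq\mathbb R$ is an interval with more than one point, $b:\Theta\to\mathbb R$ is strictly convex and twice differentiable, and $\nu_\theta$ is a probability distribution with density $e^{x\theta-b(\theta)}$ with respect to a reference measure $m$. Let $\mathcal I=\dot b(\Theta)$ and, for $\mu\in\mathcal I$, let $\nu^\mu=\nu_{\dot b^{-1}(\mu)}$ be the member of $\mathcal P$ with mean $\mu$. For $u\in\mathbb R$ and $v\in\mathcal I$ let $d(u,v)=\mathrm{KL}(\nu^u,\nu^v)$ if $u\in\mathcal I$ and, if $u\notin\mathcal I$, let $d(u,v)=\sup_\eta\big(\eta u-\ln\mathbb E_{X\sim\nu^v}[e^{\eta X}]\big)\in[0,\infty]$, where $\eta$ ranges over the reals with $\mathbb E_{X\sim\nu^v}[e^{\eta X}]<\infty$. Put $d^+(u,v)=d(u,v)\mathbf 1_{(u\le v)}$ and $d^-(u,v)=d(u,v)\mathbf 1_{(u\ge v)}$. Consider a bandit with arms $1,\dots,K$ and means $\mu_1,\dots,\mu_K\in\mathcal I$. At each round $t\ge1$ an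 arm $A_t$ is selected by an arbitrary adaptive, possibly randomized, sampling rule and a reward $X_t$ is observed, whose conditional law given $(A_1,X_1,\dots,A_{t-1},X_{t-1},A_t)$ is $\nu^{\mu_{A_t}}$. Let $N_a(t)=\sum_{s\le t}\mathbf 1_{(A_s=a)}$ and $\hat\mu_a(t)=\frac1{N_a(t)}\sum_{s\le t}X_s\mathbf 1_{(A_s=a)}$. For each arm $a$ fix a choice $d_a\in\{d,d^+,d^-\}$ and let $$X_a(t)=\big[N_a(t)\,d_a(\hat\mu_a(t),\mu_a)-3\ln(1+\ln N_a(t))\big]^+ ,$$ with $X_a(t)=0$ if $N_a(t)=0$. Let $h(u)=u-\ln u$ for $u\ge1$, with inverse $h^{-1}:[1,\infty)\to[1,\infty)$; for $z\in(1,e]$ and $x\ge 0$ let $$\tilde h_z(x)=\begin{cases}e^{1/h^{-1}(x)}\,h^{-1}(x)&\text{if }x\ge h(1/\ln z),\\ z\,(x-\ln\ln z)&\text{otherwise,}\end{cases}$$ and let $$\mathcal T(x)=2\,\tilde h_{3/2}\!\left(\frac{h^{-1}(1+x)+\ln(2\zeta(2))}{2}\right),\qquad \zeta(s)=\sum_{n\ge1}n^{-s}.$$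 Then for every non-empty set $\mathcal S\subseteq\{1,\dots,K\}$ of arms and every $x\ge0$, $$\mathbb P\Big(\exists t\in\mathbb N:\ \sum_{a\in\mathcal S}X_a(t)\ \ge\ |\mathcal S|\,\mathcal T\big(x/|\mathcal S|\big)\Big)\le e^{-x}.$$ -/

import Mathlib

open MeasureTheory ProbabilityTheory
open scoped ENNReal

namespace BanditDeviation

noncomputable section

/-! ### The threshold function -/

/-- `h u = u - ln u`, considered on `[1, ∞)`, where it is a bijection onto `[1, ∞)`. -/
def h (u : ℝ) : ℝ := u - Real.log u

/-- The inverse `h⁻¹ : [1, ∞) → [1, ∞)` of `h`. -/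
def hInv (x : ℝ) : ℝ := Function.invFunOn h (Set.Ici 1) x

/-- The function `h̃_z(x)`, for `z ∈ [1, e]` and `x ≥ 0`. -/
def hTilde (z x : ℝ) : ℝ :=
  if h (1 / Real.log z) ≤ x then Real.exp (1 / hInv x) * hInv x
  else z * (x - Real.log (Real.log z))

/-- `ζ(s) = ∑_{n ≥ 1} n^{-s}` for real `s > 1`. -/
def zeta (s : ℝ) : ℝ := ∑' n : ℕ, ((n : ℝ) + 1) ^ (-s)

/-- The threshold `𝒯(x) = 2 h̃_{3/2}((h⁻¹(1 + x) + ln(2 ζ(2))) / 2)`, for `x ≥ 0`. -/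
def threshold (x : ℝ) : ℝ :=
  2 * hTilde (3 / 2) ((hInv (1 + x) + Real.log (2 * zeta 2)) / 2)

/-! ### One-parameter canonical exponential families -/

/-- A one-parameter canonical exponential family on `ℝ`: a set `Θ` of natural parameters (convex,
as the domain of the strictly convex function `b`, and with more than one point, so that `b` has
a derivative on it), a strictly convex twice-differentiable log-partition function `b` on `Θ`, and
a reference measure `m` for which `x ↦ exp (x θ - b θ)` is a probability density for every
`θ ∈ Θ`. At an end point of `Θ` that belongs to `Θ`, derivatives are one-sided. -/
structure ExpFamily where
  Θ : Set ℝ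
  b : ℝ → ℝ
  m : Measure ℝ
  nontrivial : Θ.Nontrivial
  strictConvex : StrictConvexOn ℝ Θ b
  differentiable : DifferentiableOn ℝ b Θ
  twice_differentiable : DifferentiableOn ℝ (derivWithin b Θ) Θ
  normalized : ∀ θ ∈ Θ, ∫⁻ x, ENNReal.ofReal (Real.exp (x * θ - b θ)) ∂m = 1

namespace ExpFamily

variable (F : ExpFamily)

/-- The distribution `ν_θ`, with density `exp (x θ - b θ)` with respect to `m`. -/
def dist (θ : ℝ) : Measure ℝ :=
  F.m.withDensity fun x => ENNReal.ofReal (Real.exp (x * θ - F.b θ))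

/-- The mean `b'(θ)` of `ν_θ`. -/
def mean (θ : ℝ) : ℝ := derivWithin F.b F.Θ θ

/-- The set `I = b'(Θ)` of possible means. -/
def meanSet : Set ℝ := F.mean '' F.Θ

/-- The distribution `ν^μ` of the family with mean `μ ∈ I`, that is `ν_θ` for `θ = (b')⁻¹(μ)`. -/
def meanDist (μ : ℝ) : Measure ℝ := F.dist (Function.invFunOn F.mean F.Θ μ)

open Classical in
/-- The divergence `d(u, v)` for `v ∈ I`. If `u ∈ I` it is the Kullback-Leibler divergence
`KL(ν^u, ν^v)`. An empirical mean may be a real number `u` outside `I` (for instance `0` or `1`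
for Bernoulli distributions); `d(u, v)` is then given by the variational formula
`sup_η (η u - φ_v(η))`, with `φ_v(η) = ln E_{X ∼ ν^v} [e^{η X}]` the cumulant generating function
of `ν^v` and `η` ranging over the reals at which it is finite. -/
def divergence (u v : ℝ) : ℝ≥0∞ :=
  if u ∈ F.meanSet then InformationTheory.klDiv (F.meanDist u) (F.meanDist v)
  else ⨆ η ∈ integrableExpSet id (F.meanDist v),
    ENNReal.ofReal (η * u - cgf id (F.meanDist v) η)

end ExpFamily

/-- Which deviations of an arm are measured: two-sided ones through `d`, those of an empirical
mean `≤ μ` through `d⁺`, or those of an empirical mean `≥ μ` through `d⁻`. -/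
inductive Side
  | both
  | plus
  | minus

open Classical in
/-- `d(u, v)`, `d⁺(u, v) = d(u, v) 1_{u ≤ v}` or `d⁻(u, v) = d(u, v) 1_{u ≥ v}`. -/
def sidedDivergence (F : ExpFamily) : Side → ℝ → ℝ → ℝ≥0∞
  | Side.both, u, v => F.divergence u v
  | Side.plus, u, v => if u ≤ v then F.divergence u v else 0
  | Side.minus, u, v => if v ≤ u then F.divergence u v else 0

/-! ### The bandit model

The arm selected and the reward observed at round `s + 1` are `A s` and `X s`, for `s : ℕ`. -/

section Bandit

variable {Ω : Type*} {K : ℕ}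

/-- The sigma-algebra `σ(A_1, X_1, …, A_t, X_t)` generated by the first `t` rounds. -/
@[reducible] def past (A : ℕ → Ω → Fin K) (X : ℕ → Ω → ℝ) (t : ℕ) : MeasurableSpace Ω :=
  ⨆ (s : ℕ) (_ : s < t),
    MeasurableSpace.comap (A s) inferInstance ⊔ MeasurableSpace.comap (X s) inferInstance

/-- `(A, X)` is an interaction with the exponential family bandit with means `μ`: in every round,
given the past rounds and the selected arm `a`, the reward has law `ν^{μ_a}`. The sampling rule is
arbitrary: the selected arm may depend in any way on the past rounds and on external
randomization (such as a uniform variable independent of the past). -/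
structure IsBandit [MeasurableSpace Ω] (P : Measure Ω) (F : ExpFamily) (μ : Fin K → ℝ)
    (A : ℕ → Ω → Fin K) (X : ℕ → Ω → ℝ) : Prop where
  measurable_arm : ∀ t, Measurable (A t)
  measurable_reward : ∀ t, Measurable (X t)
  reward_law : ∀ (t : ℕ) (B : Set ℝ), MeasurableSet B →
    P⟦X t ⁻¹' B | past A X t ⊔ MeasurableSpace.comap (A t) inferInstance⟧
      =ᵐ[P] fun ω => (F.meanDist (μ (A t ω))).real B

/-- The number `N_a(t)` of selections of arm `a` in the first `t` rounds. -/
def count (A : ℕ → Ω → Fin K) (a : Fin K) (t : ℕ) (ω : Ω) : ℕ :=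
  ((Finset.range t).filter fun s => A s ω = a).card

/-- The sum `S_a(t)` of the rewards of arm `a` in the first `t` rounds. -/
def rewardSum (A : ℕ → Ω → Fin K) (X : ℕ → Ω → ℝ) (a : Fin K) (t : ℕ) (ω : Ω) : ℝ :=
  ∑ s ∈ (Finset.range t).filter (fun s => A s ω = a), X s ω

/-- The empirical mean `S_a(t) / N_a(t)` (used only when `N_a(t) ≠ 0`). -/
def empMean (A : ℕ → Ω → Fin K) (X : ℕ → Ω → ℝ) (a : Fin K) (t : ℕ) (ω : Ω) : ℝ :=
  rewardSum A X a t ω / count A a t ω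

/-- The corrected deviation `[N_a(t) d(μ̂_a(t), μ_a) - 3 ln (1 + ln N_a(t))]⁺` of arm `a`, with `d`,
`d⁺` or `d⁻` according to `side`, as an extended nonnegative real (in which subtraction is the
positive part of the difference); it is `0` as long as arm `a` has not been selected. -/
def deviation (F : ExpFamily) (μ : Fin K → ℝ) (A : ℕ → Ω → Fin K) (X : ℕ → Ω → ℝ) (side : Side)
    (a : Fin K) (t : ℕ) (ω : Ω) : ℝ≥0∞ :=
  if count A a t ω = 0 then 0
  else (count A a t ω : ℝ≥0∞) * sidedDivergence F side (empMean A X a t ω) (μ a)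
    - ENNReal.ofReal (3 * Real.log (1 + Real.log (count A a t ω)))

end Bandit

end

end BanditDeviation

namespace BanditDeviation

/-! ### The function `h` and the threshold -/

/-! For a fixed dual variable `η`, the likelihood ratio `exp (η S - N φ(η))` of an arm is a
nonnegative martingale, and so is any mixture over `η` with fixed weights. Each round changes the
factor of one arm only, so the product over the arms of such mixtures is again a martingale,
whatever the sampling rule, and Ville's inequality bounds its supremum over time. It remains to
find, for one arm, a mixture that dominates the exponential of the deviation at all times.

Peeling provides it. On a slice `z ^ i ≤ N < z ^ (i + 1)`, one dual variable per side of the mean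
detects every deviation above a given level (`exists_dual_of_le`, `exists_slice_dual`). Weights
proportional to `(i + 1) ^ (-2)` are paid for by the `3 ln (1 + ln N)` correction and the constant
`peelConst z`. To avoid fixing the level in advance, `exists_mixture` also mixes over levels, a
discrete form of `exp (λ y) = 1 + ∫₀^y λ exp (-(1 - λ) t) exp t dt`, whose total mass is `1 / (1 -
λ)`. A deviation `z (y + peelConst z)` then forces the mixture above `exp (λ y)`, up to a factor
`exp ε`.

If the deviations add up to `n z (s + peelConst z)`, the values `y` add up to at least `n s`, and
Ville gives `((1 - λ)⁻¹ exp (-λ s)) ^ n`. With `λ = 1 - 1 / s` this is `exp (-n (h s - 1))`, equal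
to `exp (-x)` for `s = h⁻¹(1 + x / n)`. The threshold is `z (s + peelConst z)` at a suitable `z`
(`exists_threshold_eq`).

The divergence enters only through the upper bound by the Legendre transform of the cumulant
generating function (`ExpFamily.divergence_le_rate`), so boundary means and one-sided variants need
no separate treatment. -/

lemma h_one : h 1 = 1 := by simp [h]

lemma h_strictMonoOn : StrictMonoOn h (Set.Ici 1) := by
  intro u hu v hv huv
  have hu0 : 0 < u := lt_of_lt_of_le one_pos hu
  have hv0 : 0 < v := hu0.trans huv
  have h1 : Real.log (v / u) < v / u - 1 :=
    Real.log_lt_sub_one_of_pos (div_pos hv0 hu0) (by rw [Ne, div_eq_one_iff_eq hu0.ne']; exact huv.ne')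
  have h2 : v / u - 1 ≤ v - u := by
    rw [div_sub_one hu0.ne', div_le_iff₀ hu0]
    have : (1 : ℝ) ≤ u := hu
    nlinarith
  rw [Real.log_div hv0.ne' hu0.ne'] at h1
  simp only [h]
  linarith

lemma exists_h_eq {x : ℝ} (hx : 1 ≤ x) : ∃ u ∈ Set.Ici (1 : ℝ), h u = x := by
  have hc : ContinuousOn h (Set.Icc 1 (2 * x + 2)) := by
    intro u hu
    have : u ≠ 0 := (lt_of_lt_of_le one_pos hu.1).ne'
    exact (continuousAt_id.sub (Real.continuousAt_log this)).continuousWithinAt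
  have hlog : Real.log (2 * x + 2) ≤ x + 1 := by
    have h1 := Real.log_le_sub_one_of_pos (show 0 < x + 1 by linarith)
    have h2 : Real.log 2 ≤ 1 := by linarith [Real.log_le_sub_one_of_pos (show (0 : ℝ) < 2 by norm_num)]
    rw [show 2 * x + 2 = 2 * (x + 1) by ring, Real.log_mul (by norm_num) (by linarith)]
    linarith
  have hmem : x ∈ Set.Icc (h 1) (h (2 * x + 2)) := by
    rw [h_one]
    refine ⟨hx, ?_⟩
    simp only [h]
    linarith
  obtain ⟨u, hu, rfl⟩ := intermediate_value_Icc (by linarith) hc hmem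
  exact ⟨u, hu.1, rfl⟩

lemma one_le_hInv {x : ℝ} (hx : 1 ≤ x) : 1 ≤ hInv x :=
  Function.invFunOn_mem (exists_h_eq hx)

lemma h_hInv {x : ℝ} (hx : 1 ≤ x) : h (hInv x) = x :=
  Function.invFunOn_eq (exists_h_eq hx)

lemma zeta_two_summable : Summable fun n : ℕ => ((n : ℝ) + 1) ^ (-(2 : ℝ)) := by
  have := (summable_nat_add_iff 1).2 (Real.summable_nat_rpow.2 (show -(2 : ℝ) < -1 by norm_num))
  simpa using this

lemma one_le_zeta_two : 1 ≤ zeta 2 := by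
  have := zeta_two_summable.le_tsum 0 (fun n _ => by positivity)
  simpa [zeta] using this

/-- The constant `ln (2 ζ(2)) - 2 ln ln z` of a peeling argument with ratio `z`. -/
noncomputable def peelConst (z : ℝ) : ℝ := Real.log (2 * zeta 2) - 2 * Real.log (Real.log z)

lemma log_ratio_mem {z : ℝ} (hz : z ∈ Set.Ioc 1 (3 / 2 : ℝ)) : 0 < Real.log z ∧ Real.log z ≤ 1 := by
  refine ⟨Real.log_pos hz.1, ?_⟩
  have := Real.log_le_sub_one_of_pos (zero_lt_one.trans hz.1)
  linarith [hz.2]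

lemma peelConst_pos {z : ℝ} (hz : z ∈ Set.Ioc 1 (3 / 2 : ℝ)) : 0 < peelConst z := by
  have h1 := log_ratio_mem hz
  have h2 := Real.log_nonpos h1.1.le h1.2
  have h3 : 0 < Real.log (2 * zeta 2) := Real.log_pos (by linarith [one_le_zeta_two])
  unfold peelConst
  linarith

lemma exp_peelConst {z : ℝ} (hz : z ∈ Set.Ioc 1 (3 / 2 : ℝ)) :
    Real.exp (peelConst z) = 2 * zeta 2 / Real.log z ^ 2 := by
  have h1 := log_ratio_mem hz
  have h2 := one_le_zeta_two
  rw [peelConst, Real.exp_sub, Real.exp_log (by linarith), two_mul (Real.log _), Real.exp_add,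
    Real.exp_log h1.1, sq]

/-- The threshold is attained by an optimal peeling ratio. -/
lemma exists_threshold_eq {x : ℝ} (hx : 0 ≤ x) :
    ∃ z ∈ Set.Ioc 1 (3 / 2 : ℝ), threshold x = z * (hInv (1 + x) + peelConst z) := by
  have hs := one_le_hInv (show 1 ≤ 1 + x by linarith)
  set s := hInv (1 + x) with hs_def
  unfold threshold hTilde
  rw [← hs_def]
  set q := (s + Real.log (2 * zeta 2)) / 2 with hq
  have h32 := log_ratio_mem (z := 3 / 2) ⟨by norm_num, le_rfl⟩
  split_ifs with hc
  · have h1 : (1 : ℝ) ≤ 1 / Real.log (3 / 2) := by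
      rw [le_div_iff₀ h32.1]; linarith
    have h2 : 1 ≤ q := by
      have := h_strictMonoOn.monotoneOn (Set.self_mem_Ici) h1 h1
      rw [h_one] at this
      linarith
    have h3 := one_le_hInv h2
    have h4 := h_hInv h2
    set u := hInv q
    have hu0 : 0 < u := by linarith
    have h5 : 1 / Real.log (3 / 2) ≤ u := by
      by_contra! hlt
      have := h_strictMonoOn h3 h1 hlt
      linarith
    -- This ratio is the stationary point of `z (q - ln ln z)`: there `-ln ln z = ln u`, and `q + ln
    -- u = u` because `h u = q`. The case condition says exactly that it does not exceed `3 / 2`.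
    refine ⟨Real.exp (1 / u), ⟨Real.one_lt_exp_iff.2 (by positivity), ?_⟩, ?_⟩
    · rw [← Real.le_log_iff_exp_le (by norm_num), div_le_iff₀ hu0]
      rw [div_le_iff₀ h32.1] at h5
      linarith
    · have h6 : u = q + Real.log u := by simp only [h] at h4; linarith
      rw [peelConst, Real.log_exp, Real.log_div one_ne_zero hu0.ne', Real.log_one]
      nth_rewrite 2 [h6]
      rw [hq]; ring
  · refine ⟨3 / 2, ⟨by norm_num, le_rfl⟩, ?_⟩
    rw [hq, peelConst]; ring

/-! ### Conjugates of log-partition functions -/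

/-- The Legendre transform `sup_{η ∈ J} (η u - Λ η)`, with values in `[0, ∞]`. -/
noncomputable def conj (J : Set ℝ) (Λ : ℝ → ℝ) (u : ℝ) : ℝ≥0∞ :=
  ⨆ η ∈ J, ENNReal.ofReal (η * u - Λ η)

variable {J : Set ℝ} {Λ : ℝ → ℝ} {v : ℝ}

lemma le_conj {η : ℝ} (hη : η ∈ J) (u : ℝ) : ENNReal.ofReal (η * u - Λ η) ≤ conj J Λ u :=
  le_iSup₂ (f := fun η (_ : η ∈ J) => ENNReal.ofReal (η * u - Λ η)) η hη

lemma lt_conj_iff {u : ℝ} {c : ℝ≥0∞} :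
    c < conj J Λ u ↔ ∃ η ∈ J, c < ENNReal.ofReal (η * u - Λ η) := by
  simp only [conj, lt_iSup_iff, exists_prop]

lemma sub_le_toReal_conj {η : ℝ} (hη : η ∈ J) {u : ℝ} (hu : conj J Λ u ≠ ∞) :
    η * u - Λ η ≤ (conj J Λ u).toReal :=
  (ENNReal.ofReal_le_iff_le_toReal hu).1 (le_conj hη u)

/-- To the left of `v` only `η ≤ 0` matters: for `η ≥ 0` the term is at most `η v - Λ η ≤ 0` and is
truncated to zero. -/
lemma conj_antitone (hv : ∀ η ∈ J, η * v ≤ Λ η) {u u' : ℝ} (huu : u ≤ u') (hu' : u' ≤ v) :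
    conj J Λ u' ≤ conj J Λ u := by
  refine iSup₂_le fun η hη => ?_
  rcases le_total η 0 with h0 | h0
  · exact (ENNReal.ofReal_le_ofReal (by nlinarith)).trans (le_conj hη u)
  · rw [ENNReal.ofReal_of_nonpos]
    · exact zero_le
    · nlinarith [hv η hη]

lemma conj_neg (u : ℝ) : conj (-J) (fun η => Λ (-η)) (-u) = conj J Λ u := by
  refine le_antisymm (iSup₂_le fun η hη => ?_) (iSup₂_le fun η hη => ?_)
  · have := le_conj (Λ := Λ) (Set.mem_neg.1 hη) u
    simpa using this
  · have := le_conj (J := -J) (Λ := fun η => Λ (-η)) (η := -η) (by simpa using hη) (-u)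
    simpa using this

/-- A single dual variable witnesses all values `conj u ≥ ℓ` with `u ≤ v`, up to `ε`. -/
lemma exists_dual_of_le (h0 : (0 : ℝ) ∈ J) (hv : ∀ η ∈ J, η * v ≤ Λ η) {ℓ ε : ℝ} (hℓ : 0 < ℓ)
    (hε : 0 < ε) :
    ∃ η ∈ J, ∀ u ≤ v, ENNReal.ofReal ℓ ≤ conj J Λ u → conj J Λ u ≠ ∞ → ℓ - ε ≤ η * u - Λ η := by
  -- The dual variable is taken at the supremum of `U`, the hardest point. Infinite values must be
  -- excluded: at an atom on the edge of the support the transform may jump from below `ℓ` to `∞`,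
  -- and no single `η` handles all points beyond the jump.
  set U := {u | u ≤ v ∧ ENNReal.ofReal ℓ ≤ conj J Λ u ∧ conj J Λ u ≠ ∞} with hU
  rcases U.eq_empty_or_nonempty with hne | hne
  · exact ⟨0, h0, fun u h1 h2 h3 => absurd (show u ∈ U from ⟨h1, h2, h3⟩) (by simp [hne])⟩
  have hbdd : BddAbove U := ⟨v, fun u hu => hu.1⟩
  have hs_le : sSup U ≤ v := csSup_le hne fun u hu => hu.1
  set w := sSup U with hw
  have hw_top : conj J Λ w ≠ ∞ := by
    obtain ⟨u, hu⟩ := hne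
    exact ne_top_of_le_ne_top hu.2.2 (conj_antitone hv (le_csSup hbdd hu) hs_le)
  -- The supremum still satisfies the bound: by convexity on the segment from `w` to a point of `U`,
  -- where the values are finite, a value below `ℓ` at `w` would stay below `ℓ` slightly to its
  -- left.
  have key : ENNReal.ofReal ℓ ≤ conj J Λ w := by
    by_contra! hlt
    obtain ⟨u₁, hu₁⟩ := hne
    have hu₁w : u₁ < w := lt_of_le_of_ne (le_csSup hbdd hu₁) fun h => absurd hu₁.2.1 (by rw [h]; exact hlt.not_ge)
    set d₀ := (conj J Λ w).toReal
    set d₁ := (conj J Λ u₁).toReal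
    have hd₀ : d₀ < ℓ := ENNReal.toReal_lt_of_lt_ofReal hlt
    have hd₁ : 0 ≤ d₁ := ENNReal.toReal_nonneg
    have hd₀' : 0 ≤ d₀ := ENNReal.toReal_nonneg
    -- Small enough that `(1 - s) d₀ + s d₁ < ℓ`.
    set s := (ℓ - d₀) / (d₁ + ℓ + 1)
    have hs0 : 0 < s := div_pos (by linarith) (by linarith)
    have hs1 : s < 1 := by rw [div_lt_one (by linarith)]; linarith
    have hsd : s * (d₁ + ℓ + 1) = ℓ - d₀ := div_mul_cancel₀ _ (by linarith)
    obtain ⟨u₂, hu₂, hlt₂⟩ := exists_lt_of_lt_csSup (⟨u₁, hu₁⟩ : U.Nonempty)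
      (show (1 - s) * w + s * u₁ < sSup U by rw [← hw]; nlinarith)
    have h1 : ENNReal.ofReal ℓ ≤ conj J Λ ((1 - s) * w + s * u₁) :=
      hu₂.2.1.trans (conj_antitone hv hlt₂.le hu₂.1)
    have h2 : conj J Λ ((1 - s) * w + s * u₁) ≤ ENNReal.ofReal ((1 - s) * d₀ + s * d₁) := by
      refine iSup₂_le fun η hη => ENNReal.ofReal_le_ofReal ?_
      have e1 := sub_le_toReal_conj hη hw_top
      have e2 := sub_le_toReal_conj hη hu₁.2.2
      have e3 := mul_le_mul_of_nonneg_left e1 (show 0 ≤ 1 - s by linarith)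
      have e4 := mul_le_mul_of_nonneg_left e2 hs0.le
      calc η * ((1 - s) * w + s * u₁) - Λ η
          = (1 - s) * (η * w - Λ η) + s * (η * u₁ - Λ η) := by ring
        _ ≤ _ := add_le_add e3 e4
    have h3 := (ENNReal.ofReal_le_ofReal_iff (by nlinarith)).1 (h1.trans h2)
    nlinarith
  obtain ⟨η, hη, hlt⟩ := lt_conj_iff.1
    (((ENNReal.ofReal_lt_ofReal_iff hℓ).2 (show ℓ - ε < ℓ by linarith)).trans_le key)
  obtain ⟨hlt1, hpos⟩ := ENNReal.ofReal_lt_ofReal_iff'.1 hlt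
  refine ⟨η, hη, fun u h1 h2 h3 => ?_⟩
  have huw : u ≤ w := le_csSup hbdd ⟨h1, h2, h3⟩
  -- As `η ≤ 0`, moving from `w` to any smaller `u` only increases `η u - Λ η`.
  have hη0 : η ≤ 0 := by
    by_contra! hη0
    nlinarith [hv η hη]
  nlinarith

/-- Mirror image of `exists_dual_of_le` under `η ↦ -η`, `u ↦ -u`. -/
lemma exists_dual_of_ge (h0 : (0 : ℝ) ∈ J) (hv : ∀ η ∈ J, η * v ≤ Λ η) {ℓ ε : ℝ} (hℓ : 0 < ℓ)
    (hε : 0 < ε) :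
    ∃ η ∈ J, ∀ u, v ≤ u → ENNReal.ofReal ℓ ≤ conj J Λ u → conj J Λ u ≠ ∞ →
      ℓ - ε ≤ η * u - Λ η := by
  obtain ⟨η, hη, H⟩ := exists_dual_of_le (J := -J) (Λ := fun η => Λ (-η)) (v := -v) (by simpa using h0)
    (fun η hη => by simpa using hv (-η) hη) hℓ hε
  refine ⟨-η, hη, fun u h1 h2 h3 => ?_⟩
  have := H (-u) (by linarith) (by rwa [conj_neg]) (by rwa [conj_neg])
  simpa using this

/-- On the slice `z ^ i ≤ n < z ^ (i + 1)` of sample sizes, a pair of dual variables, one for each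
side of `v`, witnesses all deviations of size `z * c`. -/
lemma exists_slice_dual (h0 : (0 : ℝ) ∈ J) (hv : ∀ η ∈ J, η * v ≤ Λ η) {z : ℝ}
    (hz : z ∈ Set.Ioc 1 (3 / 2 : ℝ)) {c ε : ℝ} (hc : 0 < c) (hε : 0 < ε) (i : ℕ) :
    ∃ η : Bool → ℝ, (∀ σ, η σ ∈ J) ∧ ∀ (n : ℕ) (s : ℝ), z ^ i ≤ n → n < z ^ (i + 1) →
      conj J Λ (s / n) ≠ ∞ →
      ENNReal.ofReal (z * c) ≤
        n * conj J Λ (s / n) - ENNReal.ofReal (3 * Real.log (1 + Real.log n)) →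
      c + 2 * Real.log (1 + i * Real.log z) - ε ≤
        η (decide (s / n ≤ v)) * s - n * Λ (η (decide (s / n ≤ v))) := by
  have hz0 : 0 < z := zero_lt_one.trans hz.1
  have hlz := log_ratio_mem hz
  have hlog : 0 ≤ Real.log (1 + i * Real.log z) := Real.log_nonneg (by
    have : 0 ≤ (i : ℝ) * Real.log z := by have := hlz.1.le; positivity
    linarith)
  -- Since `ln n ≥ i ln z`, the deviation hypothesis gives `n * conj ≥ L`, so `conj ≥ L / z ^ (i +
  -- 1)` on the whole slice. Replacing `n` by the slice end points costs a factor `z` in all.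
  set L := z * c + 3 * Real.log (1 + i * Real.log z) with hL
  have hL0 : 0 < L := by have := mul_pos hz0 hc; linarith
  have hZ : 0 < z ^ (i + 1) := by positivity
  have hℓ : 0 < L / z ^ (i + 1) := div_pos hL0 hZ
  have hε' : 0 < ε / z ^ (i + 1) := div_pos hε hZ
  obtain ⟨η₁, hη₁, H₁⟩ := exists_dual_of_le h0 hv hℓ hε'
  obtain ⟨η₂, hη₂, H₂⟩ := exists_dual_of_ge h0 hv hℓ hε'
  refine ⟨fun σ => if σ then η₁ else η₂, fun σ => by cases σ <;> simpa, ?_⟩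
  intro n s hn1 hn2 htop hdev
  have hn0 : (0 : ℝ) < n := lt_of_lt_of_le (by positivity) hn1
  set u := s / n with hu
  have hs : s = n * u := by rw [hu]; field_simp
  have hlogn : i * Real.log z ≤ Real.log n := by
    rw [← Real.log_pow]
    exact Real.log_le_log (by positivity) hn1
  have hi0 : 0 ≤ (i : ℝ) * Real.log z := by have := hlz.1.le; positivity
  have hlogn' : Real.log (1 + i * Real.log z) ≤ Real.log (1 + Real.log n) :=
    Real.log_le_log (by linarith) (by linarith)
  have hzc : 0 < z * c := mul_pos hz0 hc
  have hlt := tsub_pos_iff_lt.1 (lt_of_lt_of_le (ENNReal.ofReal_pos.2 hzc) hdev)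
  have hsum := (ENNReal.le_sub_iff_add_le_right ENNReal.ofReal_ne_top hlt.le).1 hdev
  rw [← ENNReal.ofReal_add hzc.le (by linarith), ENNReal.ofReal_le_iff_le_toReal
    (ENNReal.mul_ne_top (by simp) htop), ENNReal.toReal_mul, ENNReal.toReal_natCast] at hsum
  have hD : L / z ^ (i + 1) ≤ (conj J Λ u).toReal := by
    rw [div_le_iff₀ hZ]
    have : (n : ℝ) * (conj J Λ u).toReal ≤ z ^ (i + 1) * (conj J Λ u).toReal :=
      mul_le_mul_of_nonneg_right hn2.le ENNReal.toReal_nonneg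
    linarith
  have hD' : ENNReal.ofReal (L / z ^ (i + 1)) ≤ conj J Λ u :=
    (ENNReal.ofReal_le_iff_le_toReal htop).2 hD
  have hfin : ∀ η : ℝ, L / z ^ (i + 1) - ε / z ^ (i + 1) ≤ η * u - Λ η →
      c + 2 * Real.log (1 + i * Real.log z) - ε ≤ η * s - n * Λ η := by
    intro η hη
    have h1 := mul_le_mul_of_nonneg_left hη hn0.le
    have h2 : n * (L / z ^ (i + 1)) ≥ L / z := by
      rw [ge_iff_le, div_le_iff₀ hz0, pow_succ]
      have : (n : ℝ) * (L / (z ^ i * z)) * z = (n / z ^ i) * L := by field_simp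
      rw [this]
      exact le_mul_of_one_le_left hL0.le ((one_le_div (by positivity)).2 hn1)
    have h3 : n * (ε / z ^ (i + 1)) ≤ ε := by
      rw [← mul_div_assoc, div_le_iff₀ hZ, mul_comm]
      exact mul_le_mul_of_nonneg_left hn2.le hε.le
    -- Here `z ≤ 3 / 2` is used: `3 / z ≥ 2`, and the resulting `2 ln` is what the weights `(i + 1)
    -- ^ (-2)` require.
    have h4 : c + 2 * Real.log (1 + i * Real.log z) ≤ L / z := by
      rw [le_div_iff₀ hz0, hL]
      nlinarith [hz.2]
    rw [hs]
    nlinarith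
  rcases le_or_gt u v with huv | huv
  · simp only [huv, decide_true, if_true]
    exact hfin _ (H₁ u huv hD' htop)
  · simp only [huv.not_ge, decide_false]
    exact hfin _ (H₂ u huv.le hD' htop)

/-! ### Weights of the peeling and the mixture over slices, sides and levels -/

/-- The weight of the slice `i` for one of the two sides. -/
noncomputable def sliceWeight (i : ℕ) : ℝ := ((i : ℝ) + 1) ^ (-(2 : ℝ)) / (2 * zeta 2)

lemma sliceWeight_nonneg (i : ℕ) : 0 ≤ sliceWeight i := by
  have := one_le_zeta_two
  unfold sliceWeight
  positivity

lemma tsum_sliceWeight : ∑' p : ℕ × Bool, ENNReal.ofReal (sliceWeight p.1) = 1 := by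
  have hz := one_le_zeta_two
  rw [ENNReal.tsum_prod (f := fun i (_ : Bool) => ENNReal.ofReal (sliceWeight i))]
  have : ∀ i, ∑' _ : Bool, ENNReal.ofReal (sliceWeight i)
      = ENNReal.ofReal (((i : ℝ) + 1) ^ (-(2 : ℝ)) / zeta 2) := by
    intro i
    rw [tsum_fintype, Fintype.sum_bool, ← ENNReal.ofReal_add (sliceWeight_nonneg i)
      (sliceWeight_nonneg i), sliceWeight]
    congr 1
    field_simp
    ring
  simp_rw [this]
  rw [← ENNReal.ofReal_tsum_of_nonneg (fun i => by positivity) (zeta_two_summable.div_const _),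
    tsum_div_const, ← zeta, div_self (by linarith), ENNReal.ofReal_one]

/-- The price of the weight: `ln z ≤ 1` gives `(i + 1) ln z ≤ 1 + i ln z`, so the `2 ln` term
absorbs `((i + 1) ln z) ^ 2`, and `exp (peelConst z)` supplies the remaining `2 ζ(2) / (ln z) ^ 2`.
-/
lemma sliceWeight_mul_exp {z : ℝ} (hz : z ∈ Set.Ioc 1 (3 / 2 : ℝ)) (i : ℕ) {y e : ℝ}
    (he : y + peelConst z + 2 * Real.log (1 + i * Real.log z) ≤ e) :
    Real.exp y ≤ sliceWeight i * Real.exp e := by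
  have hlz := log_ratio_mem hz
  have hζ := one_le_zeta_two
  have hi0 : 0 ≤ (i : ℝ) * Real.log z := by have := hlz.1.le; positivity
  have h1 : Real.exp y * (2 * zeta 2 / Real.log z ^ 2) * (1 + i * Real.log z) ^ 2 ≤ Real.exp e := by
    refine le_trans (le_of_eq ?_) (Real.exp_le_exp.2 he)
    rw [Real.exp_add, Real.exp_add, exp_peelConst hz, two_mul (Real.log (1 + _)), Real.exp_add,
      Real.exp_log (by linarith), sq (1 + _)]
  have h2 : (((i : ℝ) + 1) * Real.log z) ^ 2 ≤ (1 + i * Real.log z) ^ 2 := by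
    have := hlz.1.le
    gcongr
    linarith [hlz.2]
  have hw : sliceWeight i = 1 / (((i : ℝ) + 1) ^ 2 * (2 * zeta 2)) := by
    rw [sliceWeight, Real.rpow_neg (by positivity)]
    norm_cast
    field_simp
  refine le_trans ?_ (mul_le_mul_of_nonneg_left h1 (sliceWeight_nonneg i))
  rw [hw]
  have hl := hlz.1
  have h3 : Real.exp y * (((i : ℝ) + 1) * Real.log z) ^ 2 ≤ Real.exp y * (1 + i * Real.log z) ^ 2 :=
    mul_le_mul_of_nonneg_left h2 (Real.exp_pos y).le
  have h4 : 1 / (((i : ℝ) + 1) ^ 2 * (2 * zeta 2)) *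
      (Real.exp y * (2 * zeta 2 / Real.log z ^ 2) * (1 + i * Real.log z) ^ 2)
      = Real.exp y * (1 + i * Real.log z) ^ 2 / (((i : ℝ) + 1) * Real.log z) ^ 2 := by
    field_simp
  rw [h4, le_div_iff₀ (by positivity)]
  exact h3

/-- The weight of the level `k ε`. -/
noncomputable def levelWeight (lam ε : ℝ) (k : ℕ) : ℝ :=
  (Real.exp (lam * ε) - 1) * Real.exp (-(1 - lam) * ε) ^ k

lemma levelWeight_nonneg {lam ε : ℝ} (hl : 0 ≤ lam) (hε : 0 < ε) (k : ℕ) :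
    0 ≤ levelWeight lam ε k :=
  mul_nonneg (sub_nonneg.2 (Real.one_le_exp (by positivity))) (by positivity)

/-- A geometric series discretizing `1 + ∫₀^∞ λ exp (-(1 - λ) t) dt = 1 / (1 - λ)`; the mesh `ε`
costs at most the factor `exp ε`. -/
lemma tsum_levelWeight_le {lam ε : ℝ} (hl : lam ∈ Set.Ico (0 : ℝ) 1) (hε : 0 < ε) :
    1 + ∑' k, ENNReal.ofReal (levelWeight lam ε k) ≤ ENNReal.ofReal (Real.exp ε / (1 - lam)) := by
  have hκ : 0 < 1 - lam := by linarith [hl.2]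
  have hq1 : Real.exp (-(1 - lam) * ε) < 1 := Real.exp_lt_one_iff.2 (by nlinarith)
  have hsum := (hasSum_geometric_of_lt_one (Real.exp_pos _).le hq1).mul_left (Real.exp (lam * ε) - 1)
  rw [← ENNReal.ofReal_tsum_of_nonneg (levelWeight_nonneg hl.1 hε) hsum.summable]
  simp only [levelWeight]
  rw [hsum.tsum_eq, ← ENNReal.ofReal_one, ← ENNReal.ofReal_add zero_le_one
    (mul_nonneg (sub_nonneg.2 (Real.one_le_exp (mul_nonneg hl.1 hε.le)))
      (inv_nonneg.2 (by linarith)))]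
  refine ENNReal.ofReal_le_ofReal ?_
  have h1 : Real.exp (lam * ε) - 1 ≤ lam * ε * Real.exp (lam * ε) := by
    have e1 := Real.add_one_le_exp (-(lam * ε))
    have e2 := mul_le_mul_of_nonneg_right e1 (Real.exp_pos (lam * ε)).le
    rw [← Real.exp_add, neg_add_cancel, Real.exp_zero] at e2
    linarith
  have h2 : (1 - lam) * ε * Real.exp (-(1 - lam) * ε) ≤ 1 - Real.exp (-(1 - lam) * ε) := by
    have e1 := Real.add_one_le_exp ((1 - lam) * ε)
    have e2 := mul_le_mul_of_nonneg_right e1 (Real.exp_pos (-(1 - lam) * ε)).le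
    rw [← Real.exp_add, show (1 - lam) * ε + -(1 - lam) * ε = 0 by ring, Real.exp_zero] at e2
    linarith
  have h3 : (Real.exp (lam * ε) - 1) * (1 - Real.exp (-(1 - lam) * ε))⁻¹
      ≤ lam / (1 - lam) * Real.exp ε := by
    rw [← div_eq_mul_inv, div_le_iff₀ (by linarith)]
    calc Real.exp (lam * ε) - 1 ≤ lam * ε * Real.exp (lam * ε) := h1
      _ = lam / (1 - lam) * Real.exp ε * ((1 - lam) * ε * Real.exp (-(1 - lam) * ε)) := by
        have : Real.exp (lam * ε) = Real.exp ε * Real.exp (-(1 - lam) * ε) := by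
          rw [← Real.exp_add]; ring_nf
        rw [this]
        field_simp
      _ ≤ _ := mul_le_mul_of_nonneg_left h2
        (mul_nonneg (div_nonneg hl.1 hκ.le) (Real.exp_pos ε).le)
  have h4 : Real.exp ε / (1 - lam) = Real.exp ε + lam / (1 - lam) * Real.exp ε := by
    field_simp; ring
  rw [h4]
  exact add_le_add (Real.one_le_exp hε.le) h3

/-- The index set of the mixtures: a constant component, and one component for each level, slice
and side. -/
abbrev MixIndex := Unit ⊕ (ℕ × ℕ × Bool)

/-- The mixture `∑ j, w j * exp (η j * s - n * Λ (η j))`. -/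
noncomputable def mixture (Λ : ℝ → ℝ) (w : MixIndex → ℝ≥0∞) (η : MixIndex → ℝ) (n : ℕ) (s : ℝ) :
    ℝ≥0∞ :=
  ∑' j, w j * ENNReal.ofReal (Real.exp (η j * s - n * Λ (η j)))

lemma tsum_mixIndex (f : MixIndex → ℝ≥0∞) :
    ∑' j, f j = f (Sum.inl ()) + ∑' k, ∑' p, f (Sum.inr (k, p)) := by
  rw [Summable.tsum_sum ENNReal.summable ENNReal.summable,
    ← ENNReal.tsum_prod (f := fun k p => f (Sum.inr (k, p)))]
  simp

/-- A mixture of likelihood ratios that dominates the exponential of the peeled deviation. -/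
theorem exists_mixture (h0 : (0 : ℝ) ∈ J) (hΛ0 : Λ 0 = 0) (hv : ∀ η ∈ J, η * v ≤ Λ η) {z : ℝ}
    (hz : z ∈ Set.Ioc 1 (3 / 2 : ℝ)) {lam ε : ℝ} (hl : lam ∈ Set.Ico (0 : ℝ) 1) (hε : 0 < ε) :
    ∃ (w : MixIndex → ℝ≥0∞) (η : MixIndex → ℝ), (∀ j, η j ∈ J) ∧
      ∑' j, w j ≤ ENNReal.ofReal (Real.exp ε / (1 - lam)) ∧
      (∀ n s, 1 ≤ mixture Λ w η n s) ∧
      ∀ (n : ℕ) (s y : ℝ), n ≠ 0 → conj J Λ (s / n) ≠ ∞ →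
        ENNReal.ofReal (z * (y + peelConst z)) ≤
          n * conj J Λ (s / n) - ENNReal.ofReal (3 * Real.log (1 + Real.log n)) →
        ENNReal.ofReal (Real.exp (lam * y - ε)) ≤ mixture Λ w η n s := by
  have hC := peelConst_pos hz
  have hz0 : 0 < z := zero_lt_one.trans hz.1
  choose η hηJ hη using fun k i : ℕ => exists_slice_dual h0 hv hz
    (c := k * ε + peelConst z) (by positivity) hε i
  set w' : MixIndex → ℝ≥0∞ := Sum.elim 1 fun p =>
    ENNReal.ofReal (levelWeight lam ε p.1) * ENNReal.ofReal (sliceWeight p.2.1) with hw'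
  set η' : MixIndex → ℝ := Sum.elim 0 fun p => η p.1 p.2.1 p.2.2 with hη'
  have hone : ∀ n s, 1 ≤ mixture Λ w' η' n s := by
    intro n s
    rw [mixture, tsum_mixIndex]
    refine le_trans ?_ le_self_add
    simp [hw', hη', hΛ0]
  refine ⟨w', η', ?_, ?_, hone, ?_⟩
  · rintro (_ | p)
    · simpa [hη'] using h0
    · exact hηJ _ _ _
  · rw [tsum_mixIndex]
    simp only [hw', Sum.elim_inl, Sum.elim_inr, Pi.one_apply, ENNReal.tsum_mul_left,
      tsum_sliceWeight, mul_one]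
    exact tsum_levelWeight_le hl hε
  intro n s y hn htop hdev
  rcases le_or_gt y 0 with hy | hy
  · refine le_trans ?_ (hone n s)
    rw [← ENNReal.ofReal_one]
    refine ENNReal.ofReal_le_ofReal (Real.exp_le_one_iff.2 ?_)
    linarith [mul_nonpos_of_nonneg_of_nonpos hl.1 hy]
  obtain ⟨i, hi1, hi2⟩ := exists_nat_pow_near (show (1 : ℝ) ≤ n by
    exact_mod_cast Nat.one_le_iff_ne_zero.2 hn) hz.1
  set σ := decide (s / n ≤ v)
  set r := Real.exp (lam * ε) with hr
  set m := ⌊y / ε⌋₊ with hm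
  have hr1 : 0 ≤ r - 1 := sub_nonneg.2 (Real.one_le_exp (mul_nonneg hl.1 hε.le))
  -- Every level `k ε ≤ y` is exceeded, and its component for the current slice and side alone
  -- contributes this much. The sum over `k ≤ m` telescopes to `(r ^ (m + 1) - 1) exp (-ε)`, with `r
  -- ^ (m + 1) ≥ exp (λ y)`.
  have hterm : ∀ k ∈ Finset.range (m + 1), ENNReal.ofReal ((r - 1) * r ^ k * Real.exp (-ε)) ≤
      ∑' p, w' (Sum.inr (k, p)) *
        ENNReal.ofReal (Real.exp (η' (Sum.inr (k, p)) * s - n * Λ (η' (Sum.inr (k, p))))) := by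
    intro k hk
    refine le_trans ?_ (ENNReal.le_tsum (i, σ))
    have hk' : (k : ℝ) * ε ≤ y := by
      rw [← le_div_iff₀ hε]
      exact (Nat.le_floor_iff (by positivity)).1 (Nat.lt_succ_iff.1 (Finset.mem_range.1 hk))
    have h1 := hη k i n s hi1 hi2 htop (le_trans (ENNReal.ofReal_le_ofReal (by gcongr)) hdev)
    have h2 := sliceWeight_mul_exp hz i (y := k * ε - ε) (le_trans (by linarith) h1)
    simp only [hw', hη', Sum.elim_inr]
    rw [← ENNReal.ofReal_mul (levelWeight_nonneg hl.1 hε k),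
      ← ENNReal.ofReal_mul (mul_nonneg (levelWeight_nonneg hl.1 hε k) (sliceWeight_nonneg i))]
    refine ENNReal.ofReal_le_ofReal ?_
    rw [mul_assoc (levelWeight _ _ _)]
    refine le_trans (le_of_eq ?_) (mul_le_mul_of_nonneg_left h2 (levelWeight_nonneg hl.1 hε k))
    rw [levelWeight, mul_assoc, mul_assoc, hr, ← Real.exp_nat_mul, ← Real.exp_nat_mul,
      ← Real.exp_add, ← Real.exp_add]
    congr 2
    ring
  have hmix : ENNReal.ofReal (1 + (r ^ (m + 1) - 1) * Real.exp (-ε)) ≤ mixture Λ w' η' n s := by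
    rw [mixture, tsum_mixIndex, ENNReal.ofReal_add zero_le_one
      (mul_nonneg (sub_nonneg.2 (one_le_pow₀ (by linarith))) (Real.exp_pos _).le)]
    refine add_le_add (by simp [hw', hη', hΛ0]) ?_
    refine le_trans ?_ (ENNReal.sum_le_tsum (Finset.range (m + 1)))
    refine le_trans (le_of_eq ?_) (Finset.sum_le_sum hterm)
    rw [← ENNReal.ofReal_sum_of_nonneg (fun k _ => by positivity), ← Finset.sum_mul,
      ← Finset.mul_sum, mul_geom_sum]
  refine le_trans (ENNReal.ofReal_le_ofReal ?_) hmix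
  have h1 : Real.exp (lam * y) ≤ r ^ (m + 1) := by
    rw [hr, ← Real.exp_nat_mul]
    refine Real.exp_le_exp.2 ?_
    have : y ≤ (m + 1) * ε := by
      rw [← div_le_iff₀ hε]
      exact (Nat.lt_floor_add_one _).le
    push_cast
    nlinarith [hl.1, mul_le_mul_of_nonneg_left this hl.1]
  have h2 : Real.exp (-ε) ≤ 1 := Real.exp_le_one_iff.2 (by linarith)
  rw [sub_eq_add_neg, Real.exp_add]
  linarith [mul_le_mul_of_nonneg_right h1 (Real.exp_pos (-ε)).le]

/-! ### The conjugate of a cumulant generating function -/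

/-- A point of `s` below another one has a null neighbourhood; a largest point has a null half-line
containing all of `s`. No measurability of `s` is needed. -/
lemma measure_eq_zero_of_forall_Iic (ν : Measure ℝ) {s : Set ℝ} (hs : ∀ x ∈ s, ν (Set.Iic x) = 0) : ν s = 0 := by
  refine measure_null_of_locally_null s fun x hx => ?_
  by_cases h : ∃ y ∈ s, x < y
  · obtain ⟨y, hy, hxy⟩ := h
    exact ⟨_, mem_nhdsWithin_of_mem_nhds (Iic_mem_nhds hxy), hs y hy⟩
  · push Not at h
    exact ⟨_, Filter.mem_of_superset self_mem_nhdsWithin h, hs x hx⟩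

lemma measure_eq_zero_of_forall_Ici (ν : Measure ℝ) {s : Set ℝ} (hs : ∀ x ∈ s, ν (Set.Ici x) = 0) : ν s = 0 := by
  refine measure_null_of_locally_null s fun x hx => ?_
  by_cases h : ∃ y ∈ s, y < x
  · obtain ⟨y, hy, hxy⟩ := h
    exact ⟨_, mem_nhdsWithin_of_mem_nhds (Ici_mem_nhds hxy), hs y hy⟩
  · push Not at h
    exact ⟨_, Filter.mem_of_superset self_mem_nhdsWithin h, hs x hx⟩

section Cgf

variable (ν : Measure ℝ) [IsProbabilityMeasure ν]

/-- The rate function of `ν`. -/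
noncomputable abbrev rate (u : ℝ) : ℝ≥0∞ := conj (integrableExpSet id ν) (cgf id ν) u

lemma zero_mem_integrableExpSet_id : (0 : ℝ) ∈ integrableExpSet id ν := by
  simp [integrableExpSet]

/-- Jensen's inequality, by integrating the tangent line of the exponential at `η v`. -/
lemma mul_mean_le_cgf {v : ℝ} (hint : Integrable id ν) (hmean : ∫ x, x ∂ν = v) {η : ℝ}
    (hη : η ∈ integrableExpSet id ν) : η * v ≤ cgf id ν η := by
  have hη' : Integrable (fun x => Real.exp (η * x)) ν := hη
  have hid : Integrable (fun x : ℝ => x) ν := hint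
  rw [cgf, Real.le_log_iff_exp_le (mgf_pos hη)]
  have h1 : ∫ x, Real.exp (η * v) * (1 + (η * x - η * v)) ∂ν ≤ ∫ x, Real.exp (η * x) ∂ν := by
    refine integral_mono ?_ hη' fun x => ?_
    · exact ((integrable_const _).add ((hid.const_mul _).sub (integrable_const _))).const_mul _
    · have e1 := Real.add_one_le_exp (η * x - η * v)
      have e2 := mul_le_mul_of_nonneg_left e1 (Real.exp_pos (η * v)).le
      rw [← Real.exp_add, add_sub_cancel, add_comm (_ - _)] at e2
      exact e2
  have h2 : ∫ x, (1 + (η * x - η * v)) ∂ν = 1 := by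
    have e : Integrable (fun x => η * x - η * v) ν := (hid.const_mul _).sub (integrable_const _)
    rw [integral_add (integrable_const _) e, integral_sub (hid.const_mul _) (integrable_const _),
      integral_const_mul, hmean]
    simp
  rw [integral_const_mul, h2, mul_one] at h1
  exact h1

lemma lintegral_exp_sub_cgf {η : ℝ} (hη : η ∈ integrableExpSet id ν) :
    ∫⁻ x, ENNReal.ofReal (Real.exp (η * x - cgf id ν η)) ∂ν = 1 := by
  have hη' : Integrable (fun x => Real.exp (η * x)) ν := hη
  simp_rw [Real.exp_sub]
  rw [← ofReal_integral_eq_lintegral_ofReal (hη'.div_const _)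
    (ae_of_all _ fun x => by positivity), integral_div, exp_cgf hη]
  have : ∫ x, Real.exp (η * x) ∂ν = mgf id ν η := rfl
  rw [this, div_self (mgf_pos hη).ne', ENNReal.ofReal_one]

lemma measure_eq_zero_of_forall_le_exp_neg {s : Set ℝ}
    (hs : ∀ c : ℝ, 0 < c → ν.real s ≤ Real.exp (-c)) : ν s = 0 := by
  rw [← measureReal_eq_zero_iff]
  refine le_antisymm ?_ measureReal_nonneg
  have : Filter.Tendsto (fun c : ℝ => Real.exp (-c)) Filter.atTop (nhds 0) :=
    Real.tendsto_exp_neg_atTop_nhds_zero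
  refine ge_of_tendsto this ?_
  filter_upwards [Filter.eventually_gt_atTop 0] with c hc using hs c hc

/-- An infinite rate at `x` makes Chernoff's bound on the tail beyond `x` arbitrarily small, so that
tail is null. This lets the infinite values excluded in the dual selection be discarded almost
surely. -/
lemma measure_rate_eq_top {v : ℝ} (hv : ∀ η ∈ integrableExpSet id ν, η * v ≤ cgf id ν η) :
    ν {x | rate ν x = ∞} = 0 := by
  have hdual : ∀ {x : ℝ}, rate ν x = ∞ → ∀ c : ℝ, 0 < c →
      ∃ η ∈ integrableExpSet id ν, c < η * x - cgf id ν η := by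
    intro x hx c hc
    obtain ⟨η, hη, h⟩ := lt_conj_iff.1 (lt_of_lt_of_eq (ENNReal.ofReal_lt_top (r := c)) hx.symm)
    exact ⟨η, hη, (ENNReal.ofReal_lt_ofReal_iff'.1 h).1⟩
  have h1 : ∀ x ≤ v, rate ν x = ∞ → ν (Set.Iic x) = 0 := by
    intro x hxv hx
    refine measure_eq_zero_of_forall_le_exp_neg ν fun c hc => ?_
    obtain ⟨η, hη, h⟩ := hdual hx c hc
    have hη0 : η ≤ 0 := by
      by_contra! h0
      nlinarith [hv η hη]
    refine (measure_le_le_exp_cgf x hη0 hη).trans (Real.exp_le_exp.2 ?_)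
    linarith
  have h2 : ∀ x, v ≤ x → rate ν x = ∞ → ν (Set.Ici x) = 0 := by
    intro x hxv hx
    refine measure_eq_zero_of_forall_le_exp_neg ν fun c hc => ?_
    obtain ⟨η, hη, h⟩ := hdual hx c hc
    have hη0 : 0 ≤ η := by
      by_contra! h0
      nlinarith [hv η hη]
    refine (measure_ge_le_exp_cgf x hη0 hη).trans (Real.exp_le_exp.2 ?_)
    linarith
  refine measure_mono_null (t := {x | rate ν x = ∞ ∧ x ≤ v} ∪ {x | rate ν x = ∞ ∧ v ≤ x})
    (fun x hx => (le_total x v).imp (⟨hx, ·⟩) (⟨hx, ·⟩)) (measure_union_null ?_ ?_)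
  · exact measure_eq_zero_of_forall_Iic ν fun x hx => h1 x hx.2 hx.1
  · exact measure_eq_zero_of_forall_Ici ν fun x hx => h2 x hx.2 hx.1

end Cgf

/-! ### Exponential families -/

namespace ExpFamily

variable (F : ExpFamily)

lemma isProbabilityMeasure_dist {θ : ℝ} (hθ : θ ∈ F.Θ) : IsProbabilityMeasure (F.dist θ) :=
  ⟨by rw [dist, withDensity_apply _ MeasurableSet.univ, Measure.restrict_univ, F.normalized θ hθ]⟩

lemma dist_eq_withDensity (θ θ' : ℝ) :
    F.dist θ' = (F.dist θ).withDensity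
      fun x => ENNReal.ofReal (Real.exp ((θ' - θ) * x - (F.b θ' - F.b θ))) := by
  rw [dist, dist, ← withDensity_mul _ (by fun_prop) (by fun_prop)]
  congr 1
  ext x
  rw [Pi.mul_apply, ← ENNReal.ofReal_mul (Real.exp_pos _).le, ← Real.exp_add]
  ring_nf

lemma lintegral_exp {θ θ' : ℝ} (hθ' : θ' ∈ F.Θ) :
    ∫⁻ x, ENNReal.ofReal (Real.exp ((θ' - θ) * x)) ∂F.dist θ
      = ENNReal.ofReal (Real.exp (F.b θ' - F.b θ)) := by
  have := F.isProbabilityMeasure_dist hθ'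
  have h := measure_univ (μ := F.dist θ')
  rw [F.dist_eq_withDensity θ θ', withDensity_apply _ MeasurableSet.univ,
    Measure.restrict_univ] at h
  have h2 : ∀ x, ENNReal.ofReal (Real.exp ((θ' - θ) * x)) = ENNReal.ofReal (Real.exp (F.b θ' - F.b θ))
      * ENNReal.ofReal (Real.exp ((θ' - θ) * x - (F.b θ' - F.b θ))) := by
    intro x
    rw [← ENNReal.ofReal_mul (Real.exp_pos _).le, ← Real.exp_add]
    ring_nf
  simp_rw [h2]
  rw [lintegral_const_mul _ (by fun_prop), h, mul_one]

lemma integrable_exp {θ θ' : ℝ} (hθ' : θ' ∈ F.Θ) :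
    Integrable (fun x => Real.exp ((θ' - θ) * x)) (F.dist θ) := by
  refine (lintegral_ofReal_ne_top_iff_integrable (by fun_prop)
    (ae_of_all _ fun x => (Real.exp_pos _).le)).1 ?_
  rw [F.lintegral_exp hθ']
  exact ENNReal.ofReal_ne_top

lemma integral_exp {θ θ' : ℝ} (hθ' : θ' ∈ F.Θ) :
    ∫ x, Real.exp ((θ' - θ) * x) ∂F.dist θ = Real.exp (F.b θ' - F.b θ) := by
  rw [integral_eq_lintegral_of_nonneg_ae (ae_of_all _ fun x => (Real.exp_pos _).le)
    (by fun_prop), F.lintegral_exp hθ', ENNReal.toReal_ofReal (Real.exp_pos _).le]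

lemma mem_integrableExpSet {θ θ' : ℝ} (hθ' : θ' ∈ F.Θ) :
    θ' - θ ∈ integrableExpSet id (F.dist θ) := F.integrable_exp hθ'

lemma cgf_dist {θ θ' : ℝ} (hθ' : θ' ∈ F.Θ) :
    cgf id (F.dist θ) (θ' - θ) = F.b θ' - F.b θ := by
  have : mgf id (F.dist θ) (θ' - θ) = Real.exp (F.b θ' - F.b θ) := F.integral_exp hθ'
  rw [cgf, this, Real.log_exp]

/-- Chords of the convex function `t ↦ exp (t y)` from `0` have increasing slopes. -/
lemma slope_exp_monotone (y : ℝ) {s t : ℝ} (hs : 0 < s) (hst : s ≤ t) :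
    (Real.exp (s * y) - 1) / s ≤ (Real.exp (t * y) - 1) / t := by
  have ht : 0 < t := hs.trans_le hst
  have h := convexOn_exp.2 (Set.mem_univ (t * y)) (Set.mem_univ 0) (div_nonneg hs.le ht.le)
    (sub_nonneg.2 ((div_le_one ht).2 hst)) (add_sub_cancel _ _)
  simp only [smul_eq_mul, mul_zero, add_zero, Real.exp_zero, mul_one] at h
  rw [show s / t * (t * y) = s * y by field_simp] at h
  rw [div_le_iff₀ hs]
  have h2 : (Real.exp (t * y) - 1) / t * s = s / t * Real.exp (t * y) - s / t := by
    field_simp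
  rw [h2]
  linarith

/-- `ν_θ` is integrable with mean `b'(θ)`, also when `θ` is an end point of `Θ`. -/
theorem integrable_and_integral_dist {θ : ℝ} (hθ : θ ∈ F.Θ) :
    Integrable id (F.dist θ) ∧ ∫ x, x ∂F.dist θ = F.mean θ := by
  have := F.isProbabilityMeasure_dist hθ
  obtain ⟨θ', hθ', hne⟩ := F.nontrivial.exists_ne θ
  set δ := θ' - θ with hδ
  have hδ0 : δ ≠ 0 := sub_ne_zero.2 hne
  set s : ℕ → ℝ := fun n => 1 / ((n : ℝ) + 1) with hs
  have hs0 : ∀ n, 0 < s n := fun n => by positivity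
  have hs1 : ∀ n, s n ≤ 1 := fun n => by
    rw [hs]; simp only; rw [div_le_one (by positivity)]; linarith [n.cast_nonneg (α := ℝ)]
  have hsanti : Antitone s := fun m n hmn => by
    simp only [hs]
    gcongr
  have hslim : Filter.Tendsto s Filter.atTop (nhds 0) := tendsto_one_div_add_atTop_nhds_zero_nat
  have hmem : ∀ t ∈ Set.Icc (0 : ℝ) 1, θ + t * δ ∈ F.Θ := fun t ht => by
    have := F.strictConvex.1.add_smul_sub_mem hθ hθ' ht
    simpa [hδ] using this
  have hslim' : Filter.Tendsto s Filter.atTop (nhdsWithin 0 (Set.Icc 0 1 \ {0})) :=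
    tendsto_nhdsWithin_iff.2 ⟨hslim, Filter.Eventually.of_forall fun n =>
      ⟨⟨(hs0 n).le, hs1 n⟩, (hs0 n).ne'⟩⟩
  -- Difference quotients in a direction `δ` pointing into `Θ`, so that end points are covered. They
  -- decrease to `δ x`, and their integrals tend to `δ b'(θ)`.
  set φ : ℕ → ℝ → ℝ := fun n x => (Real.exp (s n * (δ * x)) - 1) / s n with hφ
  have hexp : ∀ n, Integrable (fun x => Real.exp (s n * (δ * x))) (F.dist θ) := fun n => by
    have := F.integrable_exp (θ := θ) (hmem (s n) ⟨(hs0 n).le, hs1 n⟩)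
    simpa [mul_assoc] using this
  have hφint : ∀ n, Integrable (φ n) (F.dist θ) := fun n =>
    ((hexp n).sub (integrable_const _)).div_const _
  have hφval : ∀ n, ∫ x, φ n x ∂F.dist θ = (Real.exp (F.b (θ + s n * δ) - F.b θ) - 1) / s n := by
    intro n
    have h := F.integral_exp (θ := θ) (hmem (s n) ⟨(hs0 n).le, hs1 n⟩)
    simp only [add_sub_cancel_left, mul_assoc] at h
    simp only [hφ]
    rw [integral_div, integral_sub (hexp n) (integrable_const _), h]
    simp
  have hφanti : ∀ x, Antitone fun n => φ n x := fun x m n hmn =>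
    slope_exp_monotone (δ * x) (hs0 n) (hsanti hmn)
  have hφlim : ∀ x, Filter.Tendsto (fun n => φ n x) Filter.atTop (nhds (δ * x)) := by
    intro x
    have h1 : HasDerivAt (fun t : ℝ => Real.exp (t * (δ * x))) (δ * x) 0 := by
      have := ((hasDerivAt_id (0 : ℝ)).mul_const (δ * x)).exp
      simpa using this
    have h2 := (hasDerivWithinAt_iff_tendsto_slope.1 (h1.hasDerivWithinAt (s := Set.Icc 0 1))).comp hslim'
    refine h2.congr fun n => ?_
    simp [slope, hφ, div_eq_inv_mul]
  have hElim : Filter.Tendsto (fun n => ∫ x, φ n x ∂F.dist θ) Filter.atTop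
      (nhds (δ * F.mean θ)) := by
    have hb : HasDerivWithinAt F.b (F.mean θ) F.Θ (θ + 0 * δ) := by
      rw [zero_mul, add_zero]
      exact (F.differentiable θ hθ).hasDerivWithinAt
    have hlin : HasDerivWithinAt (fun t : ℝ => θ + t * δ) δ (Set.Icc 0 1) 0 := by
      simpa using (((hasDerivAt_id (0 : ℝ)).mul_const δ).const_add θ).hasDerivWithinAt
    have h1 := ((hb.comp 0 hlin hmem).sub_const (F.b θ)).exp
    have h2 := (hasDerivWithinAt_iff_tendsto_slope.1 h1).comp hslim'
    simp only [Function.comp_apply, zero_mul, add_zero, sub_self, Real.exp_zero, one_mul] at h2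
    rw [mul_comm]
    refine h2.congr fun n => ?_
    rw [hφval]
    simp [slope, div_eq_inv_mul]
  -- Integrability of the limit is not known beforehand; it comes from Fatou's lemma for the
  -- nonnegative `φ 0 - φ n`, whose integrals converge.
  have hdiff : Integrable (fun x => φ 0 x - δ * x) (F.dist θ) := by
    refine integrable_of_tendsto (G := fun n x => φ 0 x - φ n x)
      (ae_of_all _ fun x => (hφlim x).const_sub _)
      (fun n => ((hφint 0).sub (hφint n)).aestronglyMeasurable) ?_
    have h1 : ∀ n, ∫⁻ x, ‖φ 0 x - φ n x‖ₑ ∂F.dist θ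
        = ENNReal.ofReal (∫ x, φ 0 x ∂F.dist θ - ∫ x, φ n x ∂F.dist θ) := by
      intro n
      have h0 : ∀ x, 0 ≤ φ 0 x - φ n x := fun x => sub_nonneg.2 (hφanti x (Nat.zero_le n))
      rw [← integral_sub (hφint 0) (hφint n),
        ofReal_integral_eq_lintegral_ofReal (f := fun x => φ 0 x - φ n x)
          ((hφint 0).sub (hφint n)) (ae_of_all _ h0)]
      exact lintegral_congr fun x => by rw [Real.enorm_eq_ofReal (h0 x)]
    simp_rw [h1]
    rw [((ENNReal.tendsto_ofReal (hElim.const_sub _))).liminf_eq]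
    exact ENNReal.ofReal_ne_top
  have hint : Integrable (fun x => δ * x) (F.dist θ) := by
    have := (hφint 0).sub hdiff
    refine this.congr (ae_of_all _ fun x => ?_)
    simp
  have hval := tendsto_nhds_unique hElim
    (integral_tendsto_of_tendsto_of_antitone hφint hint (ae_of_all _ hφanti) (ae_of_all _ hφlim))
  rw [integral_const_mul] at hval
  refine ⟨?_, (mul_left_cancel₀ hδ0 hval).symm⟩
  have := hint.const_mul δ⁻¹
  refine this.congr (ae_of_all _ fun x => ?_)
  simp [hδ0]

/-- The Kullback-Leibler divergence between two members of the family. -/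
theorem klDiv_dist {θ θ' : ℝ} (hθ : θ ∈ F.Θ) (hθ' : θ' ∈ F.Θ) :
    InformationTheory.klDiv (F.dist θ') (F.dist θ)
      = ENNReal.ofReal ((θ' - θ) * F.mean θ' - (F.b θ' - F.b θ)) := by
  have := F.isProbabilityMeasure_dist hθ
  have := F.isProbabilityMeasure_dist hθ'
  obtain ⟨hint, hmean⟩ := F.integrable_and_integral_dist hθ'
  have hid : Integrable (fun x : ℝ => x) (F.dist θ') := hint
  have hac : F.dist θ' ≪ F.dist θ := by
    rw [F.dist_eq_withDensity θ θ']
    exact withDensity_absolutelyContinuous _ _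
  have hllr : llr (F.dist θ') (F.dist θ) =ᵐ[F.dist θ']
      fun x => (θ' - θ) * x - (F.b θ' - F.b θ) := by
    refine hac ?_
    have h := Measure.rnDeriv_withDensity (F.dist θ)
      (f := fun x => ENNReal.ofReal (Real.exp ((θ' - θ) * x - (F.b θ' - F.b θ)))) (by fun_prop)
    rw [← F.dist_eq_withDensity θ θ'] at h
    filter_upwards [h] with x hx
    rw [llr, hx, ENNReal.toReal_ofReal (Real.exp_pos _).le, Real.log_exp]
  have hi : Integrable (fun x => (θ' - θ) * x - (F.b θ' - F.b θ)) (F.dist θ') :=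
    (hid.const_mul _).sub (integrable_const _)
  rw [InformationTheory.klDiv_of_ac_of_integrable hac (hi.congr hllr.symm), integral_congr_ae hllr,
    integral_sub (hid.const_mul _) (integrable_const _), integral_const_mul, hmean]
  simp

section Mean

variable {F} {v : ℝ}

lemma exists_meanDist_eq (hv : v ∈ F.meanSet) :
    ∃ θ ∈ F.Θ, F.mean θ = v ∧ F.meanDist v = F.dist θ :=
  ⟨_, Function.invFunOn_mem hv, Function.invFunOn_eq hv, rfl⟩

lemma isProbabilityMeasure_meanDist (hv : v ∈ F.meanSet) :
    IsProbabilityMeasure (F.meanDist v) := by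
  obtain ⟨θ, hθ, -, h⟩ := exists_meanDist_eq hv
  rw [h]
  exact F.isProbabilityMeasure_dist hθ

lemma mul_le_cgf_meanDist (hv : v ∈ F.meanSet) :
    ∀ η ∈ integrableExpSet id (F.meanDist v), η * v ≤ cgf id (F.meanDist v) η := by
  intro η hη
  have := isProbabilityMeasure_meanDist hv
  obtain ⟨θ, hθ, hm, h⟩ := exists_meanDist_eq hv
  obtain ⟨h1, h2⟩ := F.integrable_and_integral_dist hθ
  rw [← h] at h1 h2
  exact mul_mean_le_cgf _ h1 (h2.trans hm) hη

/-- For an attainable mean `u`, the Kullback-Leibler divergence is the single term `η = θ' - θ` of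
the supremum. -/
lemma divergence_le_rate (hv : v ∈ F.meanSet) (u : ℝ) :
    F.divergence u v ≤ rate (F.meanDist v) u := by
  unfold divergence
  split_ifs with hu
  · obtain ⟨θ, hθ, hm, h⟩ := exists_meanDist_eq hv
    obtain ⟨θ', hθ', hm', h'⟩ := exists_meanDist_eq hu
    rw [h, h', F.klDiv_dist hθ hθ', hm', ← F.cgf_dist hθ']
    exact le_conj (F.mem_integrableExpSet hθ') u
  · exact le_rfl

lemma sidedDivergence_le_rate (hv : v ∈ F.meanSet) (side : Side) (u : ℝ) :
    sidedDivergence F side u v ≤ rate (F.meanDist v) u := by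
  have := divergence_le_rate hv u
  cases side <;> simp only [sidedDivergence] <;> try split_ifs
  all_goals first | exact this | exact zero_le

end Mean

end ExpFamily

/-! ### A maximal inequality -/

/-- Ville's inequality for nonnegative supermartingales, with values in `[0, ∞]`. -/
theorem mul_measure_exists_le {Ω : Type*} {m0 : MeasurableSpace Ω} (P : Measure Ω)
    (ℱ : ℕ → MeasurableSpace Ω) (hmono : Monotone ℱ) (hle : ∀ t, ℱ t ≤ m0) (Z : ℕ → Ω → ℝ≥0∞)
    (hZ : ∀ t, Measurable[ℱ t] (Z t))
    (hstep : ∀ t (B : Set Ω), MeasurableSet[ℱ t] B →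
      ∫⁻ ω in B, Z (t + 1) ω ∂P ≤ ∫⁻ ω in B, Z t ω ∂P) (c : ℝ≥0∞) :
    c * P {ω | ∃ t, c ≤ Z t ω} ≤ ∫⁻ ω, Z 0 ω ∂P := by
  set G : ℕ → Set Ω := fun t => {ω | ∃ s ≤ t, c ≤ Z s ω} with hG
  have hlev : ∀ s t, s ≤ t → MeasurableSet[ℱ t] {ω | c ≤ Z s ω} := fun s t hst =>
    hmono hst _ (hZ s measurableSet_Ici)
  have hGm : ∀ t, MeasurableSet[ℱ t] (G t) := by
    intro t
    have : G t = ⋃ s ∈ Set.Iic t, {ω | c ≤ Z s ω} := by ext ω; simp [hG]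
    rw [this]
    exact @MeasurableSet.biUnion _ _ (ℱ t) _ _ (Set.to_countable _) fun s hs => hlev s t hs
  have hG0 : ∀ t, MeasurableSet (G t) := fun t => hle t _ (hGm t)
  -- The left side is a lower bound for the expectation of the process stopped on first reaching
  -- `c`.
  have key : ∀ t, c * P (G t) + ∫⁻ ω in (G t)ᶜ, Z t ω ∂P ≤ ∫⁻ ω, Z 0 ω ∂P := by
    intro t
    induction t with
    | zero =>
      have h0 : c * P (G 0) ≤ ∫⁻ ω in G 0, Z 0 ω ∂P := by
        rw [← setLIntegral_const]
        exact setLIntegral_mono' (hG0 0) fun ω ⟨s, hs, h⟩ => by rwa [Nat.le_zero.1 hs] at h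
      calc c * P (G 0) + ∫⁻ ω in (G 0)ᶜ, Z 0 ω ∂P
          ≤ ∫⁻ ω in G 0, Z 0 ω ∂P + ∫⁻ ω in (G 0)ᶜ, Z 0 ω ∂P := add_le_add h0 le_rfl
        _ = _ := lintegral_add_compl (Z 0) (hG0 0)
    | succ t ih =>
      refine le_trans ?_ ih
      have hL : MeasurableSet {ω | c ≤ Z (t + 1) ω} := hle _ _ (hlev (t + 1) (t + 1) le_rfl)
      have hsucc : G (t + 1) = G t ∪ ((G t)ᶜ ∩ {ω | c ≤ Z (t + 1) ω}) := by
        ext ω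
        simp only [hG, Set.mem_union, Set.mem_inter_iff, Set.mem_compl_iff, Set.mem_ofPred_eq]
        constructor
        · rintro ⟨s, hs, h⟩
          by_cases hc : ∃ s ≤ t, c ≤ Z s ω
          · exact Or.inl hc
          · refine Or.inr ⟨hc, ?_⟩
            rcases Nat.le_succ_iff.1 hs with hs' | rfl
            · exact absurd ⟨s, hs', h⟩ hc
            · exact h
        · rintro (⟨s, hs, h⟩ | ⟨-, h⟩)
          · exact ⟨s, hs.trans (Nat.le_succ t), h⟩
          · exact ⟨t + 1, le_rfl, h⟩
      have hcompl : (G (t + 1))ᶜ = (G t)ᶜ \ {ω | c ≤ Z (t + 1) ω} := by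
        rw [hsucc]
        ext ω
        simp only [Set.mem_compl_iff, Set.mem_union, Set.mem_inter_iff, Set.mem_sdiff]
        tauto
      have h1 : c * P (G (t + 1)) ≤
          c * P (G t) + ∫⁻ ω in (G t)ᶜ ∩ {ω | c ≤ Z (t + 1) ω}, Z (t + 1) ω ∂P := by
        rw [hsucc]
        refine (mul_le_mul_right (measure_union_le _ _) c).trans ?_
        rw [mul_add]
        refine add_le_add_right ?_ _
        rw [← setLIntegral_const]
        exact setLIntegral_mono' ((hG0 t).compl.inter hL) fun ω hω => hω.2
      calc c * P (G (t + 1)) + ∫⁻ ω in (G (t + 1))ᶜ, Z (t + 1) ω ∂P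
          ≤ c * P (G t) + ∫⁻ ω in (G t)ᶜ ∩ {ω | c ≤ Z (t + 1) ω}, Z (t + 1) ω ∂P
            + ∫⁻ ω in (G t)ᶜ \ {ω | c ≤ Z (t + 1) ω}, Z (t + 1) ω ∂P := by
              rw [hcompl]; exact add_le_add_left h1 _
        _ = c * P (G t) + ∫⁻ ω in (G t)ᶜ, Z (t + 1) ω ∂P := by
              rw [add_assoc, lintegral_inter_add_sdiff _ _ hL]
        _ ≤ _ := add_le_add_right (hstep t _ (@MeasurableSet.compl _ _ (ℱ t) (hGm t))) _
  have hU : {ω | ∃ t, c ≤ Z t ω} = ⋃ t, G t := by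
    ext ω
    simp only [hG, Set.mem_iUnion, Set.mem_ofPred_eq]
    exact ⟨fun ⟨t, h⟩ => ⟨t, t, le_rfl, h⟩, fun ⟨_, s, _, h⟩ => ⟨s, h⟩⟩
  have hGmono : Monotone G := fun s t hst ω ⟨r, hr, h⟩ => ⟨r, hr.trans hst, h⟩
  rw [hU, hGmono.measure_iUnion, ENNReal.mul_iSup]
  exact iSup_le fun t => le_self_add.trans (key t)

/-! ### The bandit process -/

section Interaction

variable {Ω : Type*} {K : ℕ} {A : ℕ → Ω → Fin K} {X : ℕ → Ω → ℝ}

lemma past_mono : Monotone (past A X) := fun _ _ hst =>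
  iSup₂_le fun r hr => le_iSup₂_of_le r (hr.trans_le hst) le_rfl

lemma measurable_past_arm {s t : ℕ} (hst : s < t) : Measurable[past A X t] (A s) :=
  Measurable.of_comap_le (le_iSup₂_of_le s hst le_sup_left)

lemma measurable_past_reward {s t : ℕ} (hst : s < t) : Measurable[past A X t] (X s) :=
  Measurable.of_comap_le (le_iSup₂_of_le s hst le_sup_right)

lemma measurable_count [MeasurableSpace Ω] {t : ℕ} (hA : ∀ s < t, Measurable (A s)) (a : Fin K) :
    Measurable (count A a t) := by
  have : count A a t = fun ω => ∑ s ∈ Finset.range t, if A s ω = a then 1 else 0 := by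
    ext ω; rw [count, Finset.card_filter]
  rw [this]
  exact Finset.measurable_sum _ fun s hs => Measurable.ite
    (hA s (Finset.mem_range.1 hs) (measurableSet_singleton a)) measurable_const measurable_const

lemma measurable_rewardSum [MeasurableSpace Ω] {t : ℕ} (hA : ∀ s < t, Measurable (A s))
    (hX : ∀ s < t, Measurable (X s)) (a : Fin K) : Measurable (rewardSum A X a t) := by
  have : rewardSum A X a t = fun ω => ∑ s ∈ Finset.range t, if A s ω = a then X s ω else 0 := by
    ext ω; rw [rewardSum, Finset.sum_filter]
  rw [this]
  exact Finset.measurable_sum _ fun s hs => Measurable.ite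
    (hA s (Finset.mem_range.1 hs) (measurableSet_singleton a)) (hX s (Finset.mem_range.1 hs))
    measurable_const

lemma count_succ (a : Fin K) (t : ℕ) (ω : Ω) :
    count A a (t + 1) ω = count A a t ω + if A t ω = a then 1 else 0 := by
  simp only [count, Finset.card_filter, Finset.sum_range_succ]

lemma rewardSum_succ (a : Fin K) (t : ℕ) (ω : Ω) :
    rewardSum A X a (t + 1) ω = rewardSum A X a t ω + if A t ω = a then X t ω else 0 := by
  simp only [rewardSum, Finset.sum_filter, Finset.sum_range_succ]

lemma measurable_mixture (Λ : ℝ → ℝ) (w : MixIndex → ℝ≥0∞) (η : MixIndex → ℝ) :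
    Measurable fun p : ℕ × ℝ => mixture Λ w η p.1 p.2 := by
  unfold mixture
  refine Measurable.tsum fun j => ?_
  have : Measurable fun p : ℕ × ℝ => (p.1 : ℝ) := measurable_from_top.comp measurable_fst
  fun_prop

namespace IsBandit

variable [MeasurableSpace Ω] {P : Measure Ω} {F : ExpFamily} {μ : Fin K → ℝ}

lemma past_le (h : IsBandit P F μ A X) (t : ℕ) : past A X t ≤ ‹MeasurableSpace Ω› :=
  iSup₂_le fun s _ => sup_le (h.measurable_arm s).comap_le (h.measurable_reward s).comap_le

variable [IsProbabilityMeasure P]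

lemma measure_reward_mem (h : IsBandit P F μ A X) (hμ : ∀ a, μ a ∈ F.meanSet) (t : ℕ) (a : Fin K)
    {C : Set Ω} (hC : MeasurableSet[past A X t] C) {B : Set ℝ} (hB : MeasurableSet B) :
    P (X t ⁻¹' B ∩ (C ∩ A t ⁻¹' {a})) = P (C ∩ A t ⁻¹' {a}) * F.meanDist (μ a) B := by
  have := ExpFamily.isProbabilityMeasure_meanDist (hμ a)
  have hle : past A X t ⊔ MeasurableSpace.comap (A t) inferInstance ≤ ‹MeasurableSpace Ω› :=
    sup_le (h.past_le t) (h.measurable_arm t).comap_le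
  have hD : MeasurableSet[past A X t ⊔ MeasurableSpace.comap (A t) inferInstance]
      (C ∩ A t ⁻¹' {a}) :=
    @MeasurableSet.inter _ (_ ⊔ _) _ _ ((le_sup_left : past A X t ≤ _) _ hC)
      ((le_sup_right : MeasurableSpace.comap (A t) inferInstance ≤ _) _
        ⟨{a}, measurableSet_singleton a, rfl⟩)
  have hXB : MeasurableSet (X t ⁻¹' B) := h.measurable_reward t hB
  have hae : ∀ᵐ ω ∂P, ω ∈ C ∩ A t ⁻¹' {a} →
      (P⟦X t ⁻¹' B | past A X t ⊔ MeasurableSpace.comap (A t) inferInstance⟧) ω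
        = (F.meanDist (μ a)).real B := by
    filter_upwards [h.reward_law t B hB] with ω hω hmem
    have hAa : A t ω = a := hmem.2
    rw [hω, hAa]
  have h1 := setIntegral_condExp hle ((integrable_const (1 : ℝ)).indicator hXB) hD (μ := P)
  rw [setIntegral_congr_ae (hle _ hD) hae, setIntegral_const,
    integral_indicator_const _ hXB, smul_eq_mul, smul_eq_mul, mul_one,
    measureReal_restrict_apply hXB] at h1
  rw [← ENNReal.toReal_eq_toReal_iff' (measure_ne_top _ _)
    (ENNReal.mul_ne_top (measure_ne_top _ _) (measure_ne_top _ _)), ENNReal.toReal_mul]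
  exact h1.symm

/-- Given the past and the selected arm, the reward is distributed according to the arm. -/
lemma setLIntegral_mul_reward (h : IsBandit P F μ A X) (hμ : ∀ a, μ a ∈ F.meanSet) (t : ℕ)
    (a : Fin K) {C : Set Ω} (hC : MeasurableSet[past A X t] C) {G : Ω → ℝ≥0∞}
    (hG : Measurable[past A X t] G) {f : ℝ → ℝ≥0∞} (hf : Measurable f) :
    ∫⁻ ω in C ∩ A t ⁻¹' {a}, G ω * f (X t ω) ∂P
      = (∫⁻ ω in C ∩ A t ⁻¹' {a}, G ω ∂P) * ∫⁻ x, f x ∂F.meanDist (μ a) := by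
  have hm := h.past_le t
  have hX := h.measurable_reward t
  have hAa : MeasurableSet (A t ⁻¹' {a}) := h.measurable_arm t (measurableSet_singleton a)
  set Q := P.restrict (C ∩ A t ⁻¹' {a}) with hQ
  have hset : ∀ D, MeasurableSet[past A X t] D →
      ∫⁻ ω in D, f (X t ω) ∂Q = Q D * ∫⁻ x, f x ∂F.meanDist (μ a) := by
    intro D hD
    have hDC : MeasurableSet[past A X t] (D ∩ C) := @MeasurableSet.inter _ (past A X t) _ _ hD hC
    have hmap : (Q.restrict D).map (X t) = Q D • F.meanDist (μ a) := by
      ext B hB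
      rw [Measure.map_apply hX hB, Measure.restrict_apply (hX hB), hQ,
        Measure.restrict_apply ((hX hB).inter (hm _ hD)), Measure.restrict_apply (hm _ hD),
        Measure.smul_apply, smul_eq_mul, Set.inter_assoc, ← Set.inter_assoc D,
        h.measure_reward_mem hμ t a hDC hB]
    rw [← lintegral_map hf hX, hmap, lintegral_smul_measure, smul_eq_mul]
  -- On the past, weighting by `f (X t)` only multiplies the measure by a constant; integrating the
  -- past-measurable `G` against both sides gives the claim.
  have htrim : (Q.withDensity fun ω => f (X t ω)).trim hm
      = (∫⁻ x, f x ∂F.meanDist (μ a)) • Q.trim hm := by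
    refine @Measure.ext _ (past A X t) _ _ fun D hD => ?_
    rw [trim_measurableSet_eq hm hD, withDensity_apply _ (hm _ hD), hset D hD,
      Measure.smul_apply, smul_eq_mul, trim_measurableSet_eq hm hD, mul_comm]
  have h1 := lintegral_trim (μ := Q.withDensity fun ω => f (X t ω)) hm hG
  rw [htrim, lintegral_smul_measure, lintegral_trim hm hG,
    lintegral_withDensity_eq_lintegral_mul _ (f := fun ω => f (X t ω)) (hf.comp hX)
      (hG.mono hm le_rfl), smul_eq_mul] at h1
  rw [mul_comm (∫⁻ ω, G ω ∂Q), h1]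
  exact lintegral_congr fun ω => mul_comm _ _

lemma ae_reward_notMem (h : IsBandit P F μ A X) (hμ : ∀ a, μ a ∈ F.meanSet) {B : Fin K → Set ℝ}
    (hB : ∀ a, F.meanDist (μ a) (B a) = 0) : ∀ᵐ ω ∂P, ∀ t, X t ω ∉ B (A t ω) := by
  refine ae_all_iff.2 fun t => ?_
  have key : ∀ a, ∀ᵐ ω ∂P, A t ω = a → X t ω ∉ B a := by
    intro a
    -- The null sets `B a` need not be measurable, hence the measurable hulls.
    have h1 := h.measure_reward_mem hμ t a (C := Set.univ)
      (@MeasurableSet.univ _ (past A X t)) (measurableSet_toMeasurable (F.meanDist (μ a)) (B a))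
    rw [measure_toMeasurable, hB, mul_zero, Set.univ_inter] at h1
    filter_upwards [measure_eq_zero_iff_ae_notMem.1 h1] with ω hω hA hX
    exact hω ⟨subset_toMeasurable _ _ hX, hA⟩
  filter_upwards [ae_all_iff.2 key] with ω hω using hω _ rfl

end IsBandit

/-! ### Products of mixtures -/

/-- The product over the arms of `S` of mixtures of likelihood ratios. -/
noncomputable def mixtureProd (A : ℕ → Ω → Fin K) (X : ℕ → Ω → ℝ) (S : Finset (Fin K))
    (Λ : Fin K → ℝ → ℝ) (w : Fin K → MixIndex → ℝ≥0∞) (η : Fin K → MixIndex → ℝ) (t : ℕ) (ω : Ω) :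
    ℝ≥0∞ :=
  ∏ a ∈ S, mixture (Λ a) (w a) (η a) (count A a t ω) (rewardSum A X a t ω)

variable {S : Finset (Fin K)} {Λ : Fin K → ℝ → ℝ} {w : Fin K → MixIndex → ℝ≥0∞}
  {η : Fin K → MixIndex → ℝ}

lemma measurable_mixtureProd [MeasurableSpace Ω] {t : ℕ} (hA : ∀ s < t, Measurable (A s))
    (hX : ∀ s < t, Measurable (X s)) : Measurable (mixtureProd A X S Λ w η t) := by
  unfold mixtureProd
  refine Finset.measurable_fun_prod _ fun a _ => ?_
  have h1 : Measurable fun ω => (count A a t ω, rewardSum A X a t ω) :=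
    (measurable_count hA a).prodMk (measurable_rewardSum hA hX a)
  have h2 := (measurable_mixture (Λ a) (w a) (η a)).comp h1
  exact h2

lemma mixtureProd_zero (ω : Ω) : mixtureProd A X S Λ w η 0 ω = ∏ a ∈ S, ∑' j, w a j := by
  simp [mixtureProd, mixture, count, rewardSum]

/-- The martingale property. After splitting by the selected arm, only that arm's factor changes,
and each of its components is multiplied by a likelihood ratio with conditional mean one. -/
theorem IsBandit.setLIntegral_mixtureProd_succ [MeasurableSpace Ω] {P : Measure Ω}
    [IsProbabilityMeasure P] {F : ExpFamily} {μ : Fin K → ℝ} (h : IsBandit P F μ A X)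
    (hμ : ∀ a, μ a ∈ F.meanSet) (hΛ : ∀ a, Λ a = cgf id (F.meanDist (μ a)))
    (hη : ∀ a j, η a j ∈ integrableExpSet id (F.meanDist (μ a))) (t : ℕ) {C : Set Ω}
    (hC : MeasurableSet[past A X t] C) :
    ∫⁻ ω in C, mixtureProd A X S Λ w η (t + 1) ω ∂P
      = ∫⁻ ω in C, mixtureProd A X S Λ w η t ω ∂P := by
  have hm := h.past_le t
  have hCa : ∀ a, MeasurableSet (C ∩ A t ⁻¹' {a}) := fun a =>
    (hm _ hC).inter (h.measurable_arm t (measurableSet_singleton a))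
  have hsplit : ∀ f : Ω → ℝ≥0∞,
      ∫⁻ ω in C, f ω ∂P = ∑' a, ∫⁻ ω in C ∩ A t ⁻¹' {a}, f ω ∂P := by
    intro f
    rw [← lintegral_iUnion hCa]
    · congr 2
      ext ω; simp
    · intro a b hab
      refine Set.disjoint_left.2 fun ω h1 h2 => hab ?_
      exact (show A t ω = a from h1.2).symm.trans h2.2
  rw [hsplit, hsplit]
  refine tsum_congr fun a => ?_
  by_cases ha : a ∈ S
  · set R : Ω → ℝ≥0∞ := mixtureProd A X (S.erase a) Λ w η t with hR
    set G : MixIndex → Ω → ℝ≥0∞ := fun j ω => R ω * (w a j *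
      ENNReal.ofReal (Real.exp (η a j * rewardSum A X a t ω - count A a t ω * Λ a (η a j)))) with hG
    set f : MixIndex → ℝ → ℝ≥0∞ := fun j x => ENNReal.ofReal (Real.exp (η a j * x - Λ a (η a j)))
    have hf : ∀ j, Measurable (f j) := fun j => by fun_prop
    have hGm : ∀ j, Measurable[past A X t] (G j) := by
      intro j
      have h1 : Measurable[past A X t] R := @measurable_mixtureProd _ _ _ _ _ _ _ _ (past A X t) _
        (fun s hs => measurable_past_arm hs) (fun s hs => measurable_past_reward hs)
      have h2 := @measurable_count _ _ _ (past A X t) _ (fun s hs => measurable_past_arm (X := X) hs) a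
      have h3 := @measurable_rewardSum _ _ _ _ (past A X t) _
        (fun s hs => measurable_past_arm (X := X) hs) (fun s hs => measurable_past_reward hs) a
      have h4 : Measurable[past A X t] fun ω => (count A a t ω : ℝ) := measurable_from_top.comp h2
      exact h1.mul (((((h3.const_mul _).sub (h4.mul_const _)).exp).ennreal_ofReal).const_mul _)
    have hnow : ∀ ω, mixtureProd A X S Λ w η t ω = ∑' j, G j ω := by
      intro ω
      rw [mixtureProd, ← Finset.prod_erase_mul _ _ ha, mixture, ← ENNReal.tsum_mul_left]
      rfl
    have hnext : ∀ ω ∈ C ∩ A t ⁻¹' {a},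
        mixtureProd A X S Λ w η (t + 1) ω = ∑' j, G j ω * f j (X t ω) := by
      intro ω hω
      have hAa : A t ω = a := hω.2
      rw [mixtureProd, ← Finset.prod_erase_mul _ _ ha, mixture, ← ENNReal.tsum_mul_left]
      refine tsum_congr fun j => ?_
      simp only [hG, hR, mixtureProd, mul_assoc]
      congr 1
      · refine Finset.prod_congr rfl fun b hb => ?_
        have hb' : A t ω ≠ b := fun hc => (Finset.mem_erase.1 hb).1 (hc.symm.trans hAa)
        rw [count_succ, rewardSum_succ, if_neg hb', if_neg hb', add_zero, add_zero]
      · rw [← ENNReal.ofReal_mul (Real.exp_pos _).le, ← Real.exp_add, count_succ, rewardSum_succ,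
          if_pos hAa, if_pos hAa]
        congr 3
        push_cast
        ring
    have := ExpFamily.isProbabilityMeasure_meanDist (hμ a)
    have hf1 : ∀ j, ∫⁻ x, f j x ∂F.meanDist (μ a) = 1 := fun j => by
      simp only [f, hΛ]
      exact lintegral_exp_sub_cgf _ (hη a j)
    rw [setLIntegral_congr_fun (hCa a) hnext, lintegral_congr hnow, lintegral_tsum (f := fun j ω => G j ω * f j (X t ω)) fun j =>
      (((hGm j).mono hm le_rfl).mul ((hf j).comp (h.measurable_reward t))).aemeasurable,
      lintegral_tsum fun j => ((hGm j).mono hm le_rfl).aemeasurable]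
    refine tsum_congr fun j => ?_
    rw [h.setLIntegral_mul_reward hμ t a hC (hGm j) (hf j), hf1, mul_one]
  · refine setLIntegral_congr_fun (hCa a) fun ω hω => Finset.prod_congr rfl fun b hb => ?_
    have hb' : A t ω ≠ b := fun hc => ha (by rwa [← show A t ω = a from hω.2, hc])
    rw [count_succ, rewardSum_succ, if_neg hb', if_neg hb', add_zero, add_zero]

end Interaction

/-! ### From the mixtures to the deviation inequality -/

/-- Finiteness of the conjugate is inherited by averages. -/
lemma conj_average_ne_top {J : Set ℝ} {Λ : ℝ → ℝ} {ι : Type*} {T : Finset ι} (hT : T.card ≠ 0)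
    {x : ι → ℝ} (hx : ∀ i ∈ T, conj J Λ (x i) ≠ ∞) : conj J Λ ((∑ i ∈ T, x i) / T.card) ≠ ∞ := by
  have hT0 : (0 : ℝ) < T.card := by exact_mod_cast Nat.pos_of_ne_zero hT
  refine ne_top_of_le_ne_top (ENNReal.ofReal_ne_top (r := (∑ i ∈ T, (conj J Λ (x i)).toReal) / T.card))
    (iSup₂_le fun η hη => ENNReal.ofReal_le_ofReal ?_)
  rw [le_div_iff₀ hT0]
  have h1 := Finset.sum_le_sum fun i hi => sub_le_toReal_conj hη (hx i hi)
  rw [Finset.sum_sub_distrib, ← Finset.mul_sum, Finset.sum_const, nsmul_eq_mul] at h1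
  refine le_trans (le_of_eq ?_) h1
  field_simp

section Deviation

variable {Ω : Type*} {K : ℕ} {A : ℕ → Ω → Fin K} {X : ℕ → Ω → ℝ} {F : ExpFamily} {μ : Fin K → ℝ}

/-- If no reward has an infinite rate, the deviation of an arm is at most `z * (y + peelConst z)`
for some `y` whose exponential is controlled by the mixture. -/
lemma exists_deviation_le (hμ : ∀ a, μ a ∈ F.meanSet) {z lam ε : ℝ}
    (hz : z ∈ Set.Ioc 1 (3 / 2 : ℝ)) (hl : 0 ≤ lam) (hε : 0 < ε) (side : Side) (a : Fin K)
    {w : MixIndex → ℝ≥0∞} {η : MixIndex → ℝ}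
    (hone : ∀ n s, 1 ≤ mixture (cgf id (F.meanDist (μ a))) w η n s)
    (hmix : ∀ (n : ℕ) (s y : ℝ), n ≠ 0 → rate (F.meanDist (μ a)) (s / n) ≠ ∞ →
        ENNReal.ofReal (z * (y + peelConst z)) ≤
          n * rate (F.meanDist (μ a)) (s / n) - ENNReal.ofReal (3 * Real.log (1 + Real.log n)) →
        ENNReal.ofReal (Real.exp (lam * y - ε)) ≤ mixture (cgf id (F.meanDist (μ a))) w η n s)
    {ω : Ω} (hω : ∀ s, rate (F.meanDist (μ (A s ω))) (X s ω) ≠ ∞) (t : ℕ) :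
    ∃ y, 0 ≤ z * (y + peelConst z) ∧
      deviation F μ A X side a t ω ≤ ENNReal.ofReal (z * (y + peelConst z)) ∧
      ENNReal.ofReal (Real.exp (lam * y - ε)) ≤
        mixture (cgf id (F.meanDist (μ a))) w η (count A a t ω) (rewardSum A X a t ω) := by
  have hz0 : 0 < z := zero_lt_one.trans hz.1
  by_cases hN : count A a t ω = 0
  -- A negative `y` is allowed: for an unselected arm it makes the bound zero, and the constant
  -- component of the mixture suffices.
  · refine ⟨-peelConst z, by simp, by simp [deviation, hN], le_trans ?_ (hone _ _)⟩
    rw [← ENNReal.ofReal_one]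
    refine ENNReal.ofReal_le_ofReal (Real.exp_le_one_iff.2 ?_)
    have := mul_nonneg hl (peelConst_pos hz).le
    linarith
  · have htop : rate (F.meanDist (μ a)) (rewardSum A X a t ω / count A a t ω) ≠ ∞ :=
      conj_average_ne_top hN fun s hs => by
        have hA : A s ω = a := (Finset.mem_filter.1 hs).2
        have := hω s
        rwa [hA] at this
    set D : ℝ≥0∞ := count A a t ω * rate (F.meanDist (μ a)) (rewardSum A X a t ω / count A a t ω)
      - ENNReal.ofReal (3 * Real.log (1 + Real.log (count A a t ω))) with hD
    have hDtop : D ≠ ∞ := ENNReal.sub_ne_top (ENNReal.mul_ne_top (by simp) htop)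
    have hval : z * (D.toReal / z - peelConst z + peelConst z) = D.toReal := by
      field_simp
      ring
    refine ⟨D.toReal / z - peelConst z, ?_, ?_, hmix _ _ _ hN htop ?_⟩
    · rw [hval]; exact ENNReal.toReal_nonneg
    · rw [hval, ENNReal.ofReal_toReal hDtop, deviation, if_neg hN]
      exact tsub_le_tsub_right (mul_le_mul_right (ExpFamily.sidedDivergence_le_rate (hμ a) _ _) _) _
    · rw [hval, ENNReal.ofReal_toReal hDtop]

end Deviation

/-- The deviation inequality, up to a factor that tends to `1` with `ε`. -/
theorem measure_exists_threshold_le_exp_add {Ω : Type*} [MeasurableSpace Ω] (P : Measure Ω)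
    [IsProbabilityMeasure P]
    (F : BanditDeviation.ExpFamily) {K : ℕ} (μ : Fin K → ℝ) (hμ : ∀ a, μ a ∈ F.meanSet)
    (A : ℕ → Ω → Fin K) (X : ℕ → Ω → ℝ) (hAX : BanditDeviation.IsBandit P F μ A X)
    (side : Fin K → BanditDeviation.Side) (S : Finset (Fin K)) (hS : S.Nonempty)
    (x : ℝ) (hx : 0 ≤ x) {ε : ℝ} (hε : 0 < ε) :
    P {ω | ∃ t : ℕ,
        ENNReal.ofReal ((S.card : ℝ) * BanditDeviation.threshold (x / (S.card : ℝ))) ≤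
          ∑ a ∈ S, BanditDeviation.deviation F μ A X (side a) a t ω}
      ≤ ENNReal.ofReal (Real.exp (2 * S.card * ε - x)) := by
  have hn : (0 : ℝ) < S.card := by exact_mod_cast hS.card_pos
  set n : ℝ := (S.card : ℝ) with hn_def
  have hxn : 0 ≤ x / n := div_nonneg hx hn.le
  obtain ⟨z, hz, hT⟩ := exists_threshold_eq hxn
  have hz0 : 0 < z := zero_lt_one.trans hz.1
  have hs1 := one_le_hInv (show 1 ≤ 1 + x / n by linarith)
  have hs2 := h_hInv (show 1 ≤ 1 + x / n by linarith)
  set s := hInv (1 + x / n)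
  have hs0 : 0 < s := by linarith
  -- The choice of `λ` that minimizes `(1 - λ)⁻¹ exp (-λ s)`.
  have hl : 1 - 1 / s ∈ Set.Ico (0 : ℝ) 1 :=
    ⟨sub_nonneg.2 ((div_le_one hs0).2 hs1), by have : 0 < 1 / s := by positivity
                                               linarith⟩
  set lam := 1 - 1 / s with hlam
  have hprob := fun a => ExpFamily.isProbabilityMeasure_meanDist (hμ a)
  choose w η hηJ hw hone hmix using fun a => exists_mixture
    (zero_mem_integrableExpSet_id (F.meanDist (μ a))) cgf_zero
    (ExpFamily.mul_le_cgf_meanDist (hμ a)) hz hl hε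
  set Z := mixtureProd A X S (fun a => cgf id (F.meanDist (μ a))) w η with hZ
  have hville := mul_measure_exists_le P (past A X) past_mono hAX.past_le Z
    (fun t => @measurable_mixtureProd _ _ _ _ _ _ _ _ (past A X t) _
      (fun s hs => measurable_past_arm hs) (fun s hs => measurable_past_reward hs))
    (fun t C hC => (hAX.setLIntegral_mixtureProd_succ hμ (fun _ => rfl) hηJ t hC).le)
    (ENNReal.ofReal (Real.exp (n * (lam * s - ε))))
  have hZ0 : ∫⁻ ω, Z 0 ω ∂P ≤ ENNReal.ofReal (Real.exp ε * s) ^ S.card := by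
    simp only [hZ, mixtureProd_zero, lintegral_const, measure_univ, mul_one]
    refine Finset.prod_le_pow_card _ _ _ fun a _ => (hw a).trans (le_of_eq ?_)
    rw [hlam, sub_sub_cancel, div_div_eq_mul_div, div_one]
  have hgood := hAX.ae_reward_notMem hμ (B := fun a => {x | rate (F.meanDist (μ a)) x = ∞})
    fun a => measure_rate_eq_top _ (ExpFamily.mul_le_cgf_meanDist (hμ a))
  have hsub : P {ω | ∃ t : ℕ, ENNReal.ofReal (n * threshold (x / n)) ≤
      ∑ a ∈ S, deviation F μ A X (side a) a t ω} ≤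
      P {ω | ∃ t, ENNReal.ofReal (Real.exp (n * (lam * s - ε))) ≤ Z t ω} := by
    refine measure_mono_ae ?_
    filter_upwards [hgood] with ω hω
    rintro ⟨t, ht⟩
    refine ⟨t, ?_⟩
    choose y hy0 hy1 hy2 using fun a => exists_deviation_le hμ hz hl.1 hε (side a) a (hone a)
      (hmix a) hω t
    have h1 := ht.trans (Finset.sum_le_sum fun a _ => hy1 a)
    rw [← ENNReal.ofReal_sum_of_nonneg (fun a _ => hy0 a), ENNReal.ofReal_le_ofReal_iff
      (Finset.sum_nonneg fun a _ => hy0 a), hT, ← Finset.mul_sum, Finset.sum_add_distrib,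
      Finset.sum_const, nsmul_eq_mul, ← hn_def] at h1
    -- The `n` copies of `peelConst z` cancel, since the ratio `z` is common to all arms.
    have h2 : n * s ≤ ∑ a ∈ S, y a := by
      have : z * (n * s) ≤ z * ∑ a ∈ S, y a := by linarith
      exact le_of_mul_le_mul_left this hz0
    calc ENNReal.ofReal (Real.exp (n * (lam * s - ε)))
        ≤ ENNReal.ofReal (Real.exp (∑ a ∈ S, (lam * y a - ε))) := by
          refine ENNReal.ofReal_le_ofReal (Real.exp_le_exp.2 ?_)
          rw [Finset.sum_sub_distrib, ← Finset.mul_sum, Finset.sum_const, nsmul_eq_mul, ← hn_def]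
          linarith [mul_le_mul_of_nonneg_left h2 hl.1]
      _ = ∏ a ∈ S, ENNReal.ofReal (Real.exp (lam * y a - ε)) := by
          rw [Real.exp_sum, ENNReal.ofReal_prod_of_nonneg fun a _ => (Real.exp_pos _).le]
      _ ≤ Z t ω := Finset.prod_le_prod' fun a _ => hy2 a
  refine hsub.trans ?_
  have hfin : ENNReal.ofReal (Real.exp ε * s) ^ S.card =
      ENNReal.ofReal (Real.exp (n * (lam * s - ε))) * ENNReal.ofReal (Real.exp (2 * n * ε - x)) := by
    rw [← ENNReal.ofReal_mul (Real.exp_pos _).le, ← ENNReal.ofReal_pow (by positivity)]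
    congr 1
    have hxs : x = n * (s - Real.log s - 1) := by
      simp only [h] at hs2
      rw [hs2]; field_simp; ring
    have hls : lam * s = s - 1 := by rw [hlam]; field_simp
    have hes : Real.exp ε * s = Real.exp (ε + Real.log s) := by rw [Real.exp_add, Real.exp_log hs0]
    rw [hes, ← Real.exp_nat_mul, ← Real.exp_add, ← hn_def, hls]
    congr 1
    linear_combination hxs
  have h3 := hville.trans (hZ0.trans_eq hfin)
  exact (ENNReal.mul_le_mul_iff_right (by simpa using Real.exp_pos _) ENNReal.ofReal_ne_top).1 h3

end BanditDeviation

theorem theorem4p1 {Ω : Type*} [MeasurableSpace Ω] (P : Measure Ω) [IsProbabilityMeasure P]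
    (F : BanditDeviation.ExpFamily) {K : ℕ} (μ : Fin K → ℝ) (hμ : ∀ a, μ a ∈ F.meanSet)
    (A : ℕ → Ω → Fin K) (X : ℕ → Ω → ℝ) (hAX : BanditDeviation.IsBandit P F μ A X)
    (side : Fin K → BanditDeviation.Side) (S : Finset (Fin K)) (hS : S.Nonempty)
    (x : ℝ) (hx : 0 ≤ x) :
    P {ω | ∃ t : ℕ,
        ENNReal.ofReal ((S.card : ℝ) * BanditDeviation.threshold (x / (S.card : ℝ))) ≤
          ∑ a ∈ S, BanditDeviation.deviation F μ A X (side a) a t ω}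
      ≤ ENNReal.ofReal (Real.exp (-x)) := by
  -- The event does not depend on the mesh `ε`, so the discretization loss disappears as `ε → 0`.
  have hlim : Filter.Tendsto (fun ε : ℝ => ENNReal.ofReal (Real.exp (2 * S.card * ε - x)))
      (nhdsWithin 0 (Set.Ioi 0)) (nhds (ENNReal.ofReal (Real.exp (-x)))) := by
    have hc : Continuous fun ε : ℝ => ENNReal.ofReal (Real.exp (2 * S.card * ε - x)) :=
      ENNReal.continuous_ofReal.comp (by fun_prop)
    have := (hc.tendsto 0).mono_left (nhdsWithin_le_nhds (s := Set.Ioi 0))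
    simpa using this
  refine ge_of_tendsto hlim ?_
  filter_upwards [self_mem_nhdsWithin] with ε hε
  exact BanditDeviation.measure_exists_threshold_le_exp_add P F μ hμ A X hAX side S hS x hx hε
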